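/- Let $A$ be a noetherian normal ring in which $2$ is invertible (normal: the localization of $A$ at every prime is an integrally closed domain). Let $n\ge 0$, let $g(v)=\sum_{i=0}^n a_{2n-2i}v^i\in A[v]$ be monic of degree $n$ (so $a_0=1$), put $f(u)=g(u^2)=\sum_{i=0}^n a_{2n-2i}u^{2i}$, and let $\alpha\in A$ satisfy $\alpha^2=(-1)^n a_{2n}$. The type D splitting ring $B=\mathrm{DSplit}_A(f,\alpha)$ is the quotient of $A[\eta_1,\dots,\eta_n]$ by the ideal generated by the coefficients (in $u$) of $f(u)-\prod_{i=1}^n(u^2-\eta_i^2)$ together with $\eta_1\cdots\eta_n-\alpha$. The reduced discriminant of $(f,\alpha)$ is $\overline{\Delta}=\alpha\cdot\mathrm{disc}(g)\in A$. An element $a\in A$ is called squarefree if $v_{\mathfrak p}(a)\in\{0,1\}$ for every height one prime $\mathfrak p$ of $A$, where $v_{\mathfrak p}$ is the valuation of the discrete valuation ring $A_{\mathfrak p}$. A subset of $\mathrm{Spec}(A)$ has codimension $\ge 2$ if every prime in it has height $\ge 2$. Let $\widetilde E\subset\mathrm{Spec}(B)$ be the locus where at least two of the $n+\binom n2$ equations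 $\eta_i=0$ ($1\le i\le n$) and $\eta_i^2=\eta_j^2$ ($1\le i<j\le n$) hold, and let $E\subset\mathrm{Spec}(A)$ be the image of $\widetilde E$. Let $V(\overline{\Delta},\partial\overline{\Delta})\subset\mathrm{Spec}(A)$ be the set of primes $\mathfrak p$ such that the image of $\overline{\Delta}$ in $A_{\mathfrak p}$ lies in $(\mathfrak pA_{\mathfrak p})^2$. Suppose that $\overline{\Delta}$ is a non-zerodivisor in $A$. 1. If $\overline{\Delta}$ is squarefree and $E$ has codimension $\ge 2$ in $\mathrm{Spec}(A)$, then $B$ is normal. 2. If $V(\overline{\Delta},\partial\overline{\Delta})$ has codimension $\ge 2$ in $\mathrm{Spec}(A)$, then $\overline{\Delta}$ is squarefree and $B$ is normal. -/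

import Mathlib

open Polynomial

noncomputable section

namespace TypeD

universe u

/-- A ring is normal if its localization at every prime ideal is an integrally closed domain. -/
class IsNormalRing (R : Type u) [CommRing R] : Prop where
  isDomain_localization (x : PrimeSpectrum R) :
    IsDomain (Localization.AtPrime x.asIdeal)
  isIntegrallyClosed_localization (x : PrimeSpectrum R) :
    IsIntegrallyClosed (Localization.AtPrime x.asIdeal)

instance (R : Type u) [CommRing R] [IsNormalRing R] (x : PrimeSpectrum R) :
    IsDomain (Localization.AtPrime x.asIdeal) :=
  IsNormalRing.isDomain_localization x

instance (R : Type u) [CommRing R] [IsNormalRing R] (x : PrimeSpectrum R) :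
    IsIntegrallyClosed (Localization.AtPrime x.asIdeal) :=
  IsNormalRing.isIntegrallyClosed_localization x

/-- The local ring of a noetherian normal ring at a height one prime is a discrete valuation
ring. -/
theorem isDiscreteValuationRing_localization (R : Type u) [CommRing R] [IsNoetherianRing R]
    [IsNormalRing R] (x : PrimeSpectrum R) (hx : x.asIdeal.height = 1) :
    IsDiscreteValuationRing (Localization.AtPrime x.asIdeal) := by
  have hdim : ringKrullDim (Localization.AtPrime x.asIdeal) = 1 := by
    rw [IsLocalization.AtPrime.ringKrullDim_eq_height x.asIdeal, hx]
    rfl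
  have hfield : ¬ IsField (Localization.AtPrime x.asIdeal) := by
    intro h
    rw [ringKrullDim_eq_zero_of_isField h] at hdim
    exact zero_ne_one hdim
  have : Ring.KrullDimLE 1 (Localization.AtPrime x.asIdeal) :=
    (Ring.krullDimLE_iff).2 hdim.le
  have hbot : IsLocalRing.maximalIdeal (Localization.AtPrime x.asIdeal) ≠ ⊥ :=
    IsLocalRing.isField_iff_maximalIdeal_eq.not.mp hfield
  have htfae := (IsDiscreteValuationRing.TFAE _ hfield).out 0 3
  rw [htfae]
  refine ⟨inferInstance, IsLocalRing.maximalIdeal _, ⟨hbot, inferInstance⟩, ?_⟩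
  rintro P ⟨hP, hPp⟩
  exact IsLocalRing.eq_maximalIdeal
    (Ring.krullDimLE_one_iff_of_isPrime_bot.1 this P hP hPp)

/-- The (additive) valuation `v_𝔭(a)` of an element `a` of a noetherian normal ring at a height one
prime `𝔭`. -/
def primeVal {R : Type u} [CommRing R] [IsNoetherianRing R] [IsNormalRing R]
    (x : PrimeSpectrum R) (hx : x.asIdeal.height = 1) (a : R) : ℕ∞ :=
  letI := isDiscreteValuationRing_localization R x hx
  IsDiscreteValuationRing.addVal (Localization.AtPrime x.asIdeal)
    (algebraMap R (Localization.AtPrime x.asIdeal) a)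

/-- An element of a noetherian normal ring is squarefree if its valuation at each height one prime
is `0` or `1`. -/
def IsSquarefreeElt {R : Type u} [CommRing R] [IsNoetherianRing R] [IsNormalRing R]
    (a : R) : Prop :=
  ∀ (x : PrimeSpectrum R) (hx : x.asIdeal.height = 1), primeVal x hx a = 0 ∨ primeVal x hx a = 1

/-- A subset of the spectrum has codimension at least `c` if all primes it contains have height at
least `c`. -/
def CodimGE {R : Type u} [CommRing R] (c : ℕ∞) (S : Set (PrimeSpectrum R)) : Prop :=
  ∀ x ∈ S, c ≤ x.asIdeal.height

/-- The set of points of the spectrum at which `a` vanishes to order two: the image of `a` in the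
local ring at the point lies in the square of the maximal ideal. -/
def doubleVanishing {R : Type u} [CommRing R] (a : R) : Set (PrimeSpectrum R) :=
  {x | algebraMap R (Localization.AtPrime x.asIdeal) a ∈
    IsLocalRing.maximalIdeal (Localization.AtPrime x.asIdeal) ^ 2}

section Splitting

variable {A : Type u} [CommRing A]

/-- The polynomial `f(u) - ∏ᵢ (u² - ηᵢ²)` in `u`, where `f(u) = g(u²)`, with coefficients in the
polynomial ring `A[η₁, …, ηₙ]`. -/
def splitDiff (n : ℕ) (g : A[X]) : (MvPolynomial (Fin n) A)[X] :=
  (expand A 2 g).map MvPolynomial.C -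
    ∏ i : Fin n, (X ^ 2 - C (MvPolynomial.X i ^ 2))

/-- The ideal of `A[η₁, …, ηₙ]` generated by equating the coefficients of `f(u) = ∏ᵢ (u² - ηᵢ²)`,
where `f(u) = g(u²)`, together with the equation `η₁ ⋯ ηₙ = α`. -/
def splitIdeal (n : ℕ) (g : A[X]) (α : A) : Ideal (MvPolynomial (Fin n) A) :=
  Ideal.span (Set.range (fun k : ℕ => (splitDiff n g).coeff k) ∪
    {∏ i : Fin n, MvPolynomial.X i - MvPolynomial.C α})

/-- The type D splitting ring of the pair `(f, α)`, where `f(u) = g(u²)`. -/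
abbrev DSplit (n : ℕ) (g : A[X]) (α : A) : Type u :=
  MvPolynomial (Fin n) A ⧸ splitIdeal n g α

/-- The class of the `i`-th variable in the type D splitting ring. -/
def etaRoot (n : ℕ) (g : A[X]) (α : A) (i : Fin n) : DSplit n g α :=
  Ideal.Quotient.mk (splitIdeal n g α) (MvPolynomial.X i)

/-- The reduced discriminant of `(f, α)`, where `f(u) = g(u²)`: the product of `α` and the
discriminant of `g`. -/
def reducedDiscr (g : A[X]) (α : A) : A := α * g.discr

/-- The `n + n(n-1)/2` elements `ηᵢ` and `ηᵢ² - ηⱼ²` (`i < j`) of the type D splitting ring. -/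
def degeneracy (n : ℕ) (g : A[X]) (α : A) :
    Fin n ⊕ {q : Fin n × Fin n // q.1 < q.2} → DSplit n g α
  | Sum.inl i => etaRoot n g α i
  | Sum.inr q => etaRoot n g α q.1.1 ^ 2 - etaRoot n g α q.1.2 ^ 2

/-- The locus in the spectrum of the type D splitting ring where at least two of the equations
`ηᵢ = 0`, `ηᵢ² = ηⱼ²` (`i < j`) hold. -/
def badLocusTop (n : ℕ) (g : A[X]) (α : A) : Set (PrimeSpectrum (DSplit n g α)) :=
  {x | ∃ s t, s ≠ t ∧ degeneracy n g α s ∈ x.asIdeal ∧ degeneracy n g α t ∈ x.asIdeal}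

/-- The bad locus in the spectrum of the base ring: the image of the bad locus upstairs. -/
def badLocus (n : ℕ) (g : A[X]) (α : A) : Set (PrimeSpectrum A) :=
  PrimeSpectrum.comap (algebraMap A (DSplit n g α)) '' badLocusTop n g α

end Splitting

end TypeD

end

/-! Serre's criterion is used in the form: a noetherian ring is normal if each of its local rings is
an integrally closed domain or contains a regular sequence of length two in its maximal ideal. Once
`B` is known to be flat over `A` (`flat_dSplit`), the primes of `B` over a prime `p` of height at
least two cost nothing: `A_p` is normal of dimension at least two, so it has such a sequence, and
flatness carries it up (`isNormalRing_of_flat`).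

Flatness is by induction on `n`. A first root `x` and the product `y` of the others generate
`A[X,Y]/(Y² - P(X), XY - α)`, with `P = ±(g(X²) - g(0))/X²`. This is free over `A`, and over it the
remaining roots form a type D splitting ring of rank `n - 1`.

Over `p` of height at most one, `A_p` is a field or a discrete valuation ring, with maximal ideal
`(π)`, and squarefreeness gives `Δ ∣ π`. At a prime `q` of `B` over `p` outside the bad locus, at
most one degeneracy `t` vanishes; if none does, put `t = π`. Every degeneracy divides `Δ`, so `t ∣
π`. Modulo `t`, each root is a simple root of `g(X²)`, `g'(X²)` or `X`, because 2 is invertible.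
Hence `B_q/t` is unramified over `A_p`, and since `π` dies in it, it is a field. So `t` generates
the maximal ideal of `B_q`; being zero or regular, it makes `B_q` a field or a discrete valuation
ring (`IsTypeDRoots.isIntegrallyClosed`).

The second statement reduces to the first: two degeneracies over a height one prime force `π² ∣ Δ`
(`IsTypeDRoots.sq_dvd`). The hard case is two coincidences among the squares of the roots. Then `g`
and `g'` share a factor of degree two over the residue field, the Sylvester matrix drops rank by two
there, its adjugate is divisible by `π`, and so its determinant is divisible by `π²`. -/

namespace TypeD

open IsLocalRing nonZeroDivisors

/-! ### Serre's criterion via associated primes of principal ideals -/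

section Serre

/-- A local ring has a regular pair if its maximal ideal contains a regular sequence of
length two. -/
def HasRegularPair (R : Type*) [CommRing R] [IsLocalRing R] : Prop :=
  ∃ a ∈ maximalIdeal R, ∃ b ∈ maximalIdeal R, a ∈ R⁰ ∧ ∀ x, a ∣ b * x → a ∣ x

/-- A local ring satisfying the local form of Serre's conditions: it is either an integrally closed
domain or has a regular pair. -/
def IsSerreLocal (R : Type*) [CommRing R] [IsLocalRing R] : Prop :=
  (IsDomain R ∧ IsIntegrallyClosed R) ∨ HasRegularPair R

/-- Depth at least two persists as depth at least one modulo a regular `s`: no nonzero class in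
`R/(s)` is killed by the whole maximal ideal. Writing `az = su` and `bz = sv` gives `bu = av`, so `a
∣ u`, and `a` cancels. -/
theorem HasRegularPair.dvd {R : Type*} [CommRing R] [IsLocalRing R] (h : HasRegularPair R)
    {s z : R} (hs : s ∈ R⁰) (hz : ∀ r ∈ maximalIdeal R, s ∣ r * z) : s ∣ z := by
  obtain ⟨a, ha, b, hb, har, hab⟩ := h
  obtain ⟨u, hu⟩ := hz a ha
  obtain ⟨v, hv⟩ := hz b hb
  have h1 : s * (b * u) = s * (a * v) := by linear_combination (-b) * hu + a * hv
  have h2 := (mul_cancel_left_mem_nonZeroDivisors hs).1 h1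
  obtain ⟨w, rfl⟩ := hab u ⟨v, h2⟩
  have h3 : a * z = a * (s * w) := by linear_combination hu
  exact ⟨w, (mul_cancel_left_mem_nonZeroDivisors har).1 h3⟩

theorem HasRegularPair.eq_zero {R : Type*} [CommRing R] [IsLocalRing R] (h : HasRegularPair R)
    {z : R} (hz : ∀ r ∈ maximalIdeal R, r * z = 0) : z = 0 := by
  obtain ⟨a, ha, b, hb, har, hab⟩ := h
  exact (mul_left_mem_nonZeroDivisors_eq_zero_iff har).1 (hz a ha)

theorem HasRegularPair.of_ringEquiv {R S : Type*} [CommRing R] [IsLocalRing R] [CommRing S]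
    [IsLocalRing S] (e : R ≃+* S) (h : HasRegularPair R) : HasRegularPair S := by
  obtain ⟨a, ha, b, hb, har, hab⟩ := h
  have hmem : ∀ x ∈ maximalIdeal R, e x ∈ maximalIdeal S := fun x hx => by
    rw [mem_maximalIdeal, mem_nonunits_iff] at hx ⊢
    rwa [MulEquiv.isUnit_map]
  refine ⟨e a, hmem a ha, e b, hmem b hb, ?_, fun x hx => ?_⟩
  · refine mem_nonZeroDivisors_iff_right.2 fun x hx => ?_
    have : e.symm x * a = 0 := by simpa using congrArg e.symm hx
    simpa using (mul_right_mem_nonZeroDivisors_eq_zero_iff har).1 this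
  · have : a ∣ b * e.symm x := by
      have := map_dvd e.symm hx
      simpa using this
    have := map_dvd e (hab _ this)
    simpa using this

theorem IsSerreLocal.of_ringEquiv {R S : Type*} [CommRing R] [IsLocalRing R] [CommRing S]
    [IsLocalRing S] (e : R ≃+* S) (h : IsSerreLocal R) : IsSerreLocal S := by
  rcases h with ⟨h1, h2⟩ | h
  · left
    exact ⟨e.symm.isDomain_iff.2 h1 , IsIntegrallyClosed.of_equiv e⟩
  · exact Or.inr (h.of_ringEquiv e)

/-- If `P` is the ideal of all `r` with `r * z ∈ (s)`, then `s` does not divide `z` locally at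
`P`. -/
theorem not_dvd_localization {R : Type*} [CommRing R] {s z : R} (P : Ideal R) [P.IsPrime]
    (hP : ∀ r, s ∣ r * z → r ∈ P) :
    ¬ algebraMap R (Localization.AtPrime P) s ∣ algebraMap R (Localization.AtPrime P) z := by
  rintro ⟨x, hx⟩
  obtain ⟨r, t, rfl⟩ := IsLocalization.exists_mk'_eq P.primeCompl x
  have h1 : algebraMap R (Localization.AtPrime P) (t * z) = algebraMap R _ (s * r) := by
    rw [map_mul, hx, map_mul, ← IsLocalization.mk'_spec (Localization.AtPrime P) r t]
    ring
  obtain ⟨c, hc⟩ := (IsLocalization.eq_iff_exists P.primeCompl _).1 h1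
  have h2 : s ∣ ((c : R) * t) * z := ⟨c * r, by linear_combination hc⟩
  exact (c * t).2 (by simpa using hP _ h2)

theorem dvd_mul_of_mem_maximalIdeal {R : Type*} [CommRing R] {s z : R} (P : Ideal R) [P.IsPrime]
    (hP : ∀ r ∈ P, s ∣ r * z) (r : Localization.AtPrime P)
    (hr : r ∈ maximalIdeal (Localization.AtPrime P)) :
    algebraMap R (Localization.AtPrime P) s ∣ r * algebraMap R (Localization.AtPrime P) z := by
  rw [← Localization.AtPrime.map_eq_maximalIdeal] at hr
  induction hr using Submodule.span_induction with
  | zero => simp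
  | mem x h =>
    obtain ⟨x, hx, rfl⟩ := h
    rw [← map_mul]
    exact map_dvd _ (hP x hx)
  | add x y hx hy h1 h2 => rw [add_mul]; exact dvd_add h1 h2
  | smul a x hx h => rw [smul_eq_mul, mul_assoc]; exact h.mul_left a

variable {R : Type*} [CommRing R] [IsNoetherianRing R]

/-- `P` is an associated prime of the cyclic submodule of `R/(s)` generated by `b`, hence the
annihilator of some multiple `cb`. It is the prime at which a failure of divisibility is tested. -/
theorem exists_isPrime_dvd_iff {s b : R} (hb : ¬ s ∣ b) :
    ∃ (P : Ideal R) (_ : P.IsPrime) (c : R), ∀ r, r ∈ P ↔ s ∣ r * (c * b) := by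
  let N : Submodule R (R ⧸ Ideal.span {s}) := R ∙ (Ideal.Quotient.mk (Ideal.span {s}) b)
  let x : N := ⟨Ideal.Quotient.mk _ b, Submodule.mem_span_singleton_self _⟩
  have hx : x ≠ 0 := by
    intro h
    apply hb
    rw [← Ideal.mem_span_singleton, ← Ideal.Quotient.eq_zero_iff_mem]
    exact congrArg Subtype.val h
  obtain ⟨P, hP, -⟩ := exists_le_isAssociatedPrime_of_isNoetherianRing R x hx
  rw [isAssociatedPrime_iff] at hP
  obtain ⟨hP, ⟨y, hy⟩, rfl⟩ := hP
  obtain ⟨c, rfl⟩ := Submodule.mem_span_singleton.1 hy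
  refine ⟨_, hP, c, fun r => ?_⟩
  rw [Submodule.mem_colon_singleton, ← Ideal.mem_span_singleton, ← Ideal.Quotient.eq_zero_iff_mem,
    Submodule.mem_bot, ← Subtype.val_inj]
  simp [Algebra.smul_def]

/-- If `b/s` is integral but `s ∤ b`, localize at an associated prime `P = (s : cb)`. There `s`
still does not divide `cb`. In an integrally closed domain this contradicts integrality; with a
regular pair it contradicts `HasRegularPair.dvd`, since `P` multiplies `cb` into `(s)`. -/
theorem isIntegrallyClosed_of_isSerreLocal
    (h : ∀ (P : Ideal R) [P.IsPrime], IsSerreLocal (Localization.AtPrime P)) :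
    IsIntegrallyClosed R := by
  rw [isIntegrallyClosed_iff (FractionRing R)]
  intro x hx
  obtain ⟨b, s, rfl⟩ := IsLocalization.exists_mk'_eq R⁰ x
  suffices hdvd : (s : R) ∣ b by
    obtain ⟨c, rfl⟩ := hdvd
    exact ⟨c, by rw [IsLocalization.mk'_mul_cancel_left]⟩
  by_contra hb
  obtain ⟨P, hPp, c, hP⟩ := exists_isPrime_dvd_iff hb
  refine not_dvd_localization P (fun r => (hP r).2) ?_
  have hnzd : algebraMap R (Localization.AtPrime P) s ∈ (Localization.AtPrime P)⁰ :=
    IsLocalization.map_nonZeroDivisors_le P.primeCompl _ ⟨s, s.2, rfl⟩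
  rcases h P with ⟨h1, h2⟩ | h
  · let K := FractionRing (Localization.AtPrime P)
    have hle : R⁰ ≤ Submonoid.comap (algebraMap R (Localization.AtPrime P))
        (Localization.AtPrime P)⁰ :=
      fun y hy => IsLocalization.map_nonZeroDivisors_le P.primeCompl _ ⟨y, hy, rfl⟩
    let φ : FractionRing R →+* K := IsLocalization.map K (algebraMap R (Localization.AtPrime P)) hle
    have hint := hx.map_of_comp_eq (algebraMap R (Localization.AtPrime P)) φ
      (IsLocalization.map_comp hle).symm
    rw [IsLocalization.map_mk'] at hint
    obtain ⟨y, hy⟩ := IsIntegrallyClosed.algebraMap_eq_of_integral hint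
    rw [eq_comm, IsLocalization.mk'_eq_iff_eq_mul, ← map_mul] at hy
    have := IsFractionRing.injective (Localization.AtPrime P) K hy
    rw [map_mul]
    exact Dvd.dvd.mul_left ⟨y, by rw [this, mul_comm]⟩ _
  · exact h.dvd hnzd fun r hr => dvd_mul_of_mem_maximalIdeal P (fun r hr => (hP r).1 hr) r hr

/-- The same localization argument with `s = 0`, applied to a nilpotent element. -/
theorem isReduced_of_isSerreLocal
    (h : ∀ (P : Ideal R) [P.IsPrime], IsSerreLocal (Localization.AtPrime P)) :
    IsReduced R := by
  refine ⟨fun w hw => ?_⟩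
  by_contra hne
  obtain ⟨P, hPp, c, hP⟩ := exists_isPrime_dvd_iff (s := 0) (b := w) (by rwa [zero_dvd_iff])
  refine not_dvd_localization P (fun r => (hP r).2) ?_
  rw [map_zero, zero_dvd_iff]
  rcases h P with ⟨h1, h2⟩ | h
  · have := (hw.map (algebraMap R (Localization.AtPrime P))).eq_zero
    rw [map_mul, this, mul_zero]
  · refine h.eq_zero fun r hr => ?_
    simpa using dvd_mul_of_mem_maximalIdeal P (fun r hr => (hP r).1 hr) r hr

/-- A reduced noetherian local ring that is integrally closed in its total ring of fractions is a
domain. -/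
theorem isDomain_of_isIntegrallyClosed [IsLocalRing R] [IsReduced R] [IsIntegrallyClosed R] :
    IsDomain R := by
  have : NoZeroDivisors R := by
    refine ⟨fun {a b} hab => ?_⟩
    by_contra! hne
    have hsq : ∀ w : R, w * w = 0 → w = 0 := fun w hw =>
      IsReduced.eq_zero w ⟨2, by rw [pow_two, hw]⟩
    let I : Ideal R := LinearMap.ker (LinearMap.mulLeft R a)
    have hI : ∀ x, x ∈ I ↔ a * x = 0 := fun x => by simp [I]
    let J : Ideal R := Submodule.annihilator I
    have hJ : ∀ x, x ∈ J ↔ ∀ y ∈ I, x * y = 0 := fun x => by simp [J, Submodule.mem_annihilator]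
    have hIJ : ∀ x ∈ I, x ∈ J → x = 0 := fun x hx hx' => hsq x ((hJ x).1 hx' x hx)
    have haJ : a ∈ J := (hJ a).2 fun y hy => (hI y).1 hy
    -- With `I = Ann(a)` and `J = Ann(I)`, reducedness gives `I ∩ J = 0`, so nothing nonzero kills
    -- `I + J`. A faithful ideal of a noetherian ring contains a regular element `x + y`; since `xy
    -- = 0`, the fraction `x/(x + y)` is idempotent, hence integral, hence in `R`, and a local ring
    -- has only the idempotents 0 and 1.
    have : FaithfulSMul R (I ⊔ J : Ideal R) := by
      rw [← Module.annihilator_eq_bot, eq_bot_iff]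
      intro y hy
      rw [Submodule.mem_annihilator] at hy
      have h1 : y ∈ J := (hJ y).2 fun z hz => hy z (Ideal.mem_sup_left hz)
      have h2 : y ∈ I := (hI y).2 (by
        rw [mul_comm]; exact hy a (Ideal.mem_sup_right haJ))
      exact hIJ y h2 h1
    obtain ⟨s, hs, hs0⟩ := Ideal.nonempty_inter_nonZeroDivisors_of_faithfulSMul (I := I ⊔ J)
    obtain ⟨x, hx, y, hy, rfl⟩ := Submodule.mem_sup.1 hs
    have hyx : y * x = 0 := (hJ y).1 hy x hx
    let q : FractionRing R := IsLocalization.mk' _ x ⟨x + y, hs0⟩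
    have hqs : q * algebraMap R _ (x + y) = algebraMap R _ x := IsLocalization.mk'_spec _ _ _
    have hq : q * q = q := by
      have hu : IsUnit (algebraMap R (FractionRing R) (x + y)) :=
        IsLocalization.map_units _ (⟨x + y, hs0⟩ : R⁰)
      refine (hu.mul hu).mul_left_injective ?_
      have h0 : algebraMap R (FractionRing R) x * algebraMap R _ x =
          algebraMap R _ x * algebraMap R _ (x + y) := by
        rw [← map_mul, ← map_mul]; congr 1; linear_combination -hyx
      calc q * q * (algebraMap R _ (x + y) * algebraMap R _ (x + y))
          = (q * algebraMap R _ (x + y)) * (q * algebraMap R _ (x + y)) := by ring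
        _ = (q * algebraMap R _ (x + y)) * algebraMap R _ (x + y) := by rw [hqs, h0]
        _ = _ := by ring
    have hint : IsIntegral R q := by
      refine ⟨X ^ 2 - X, monic_X_pow_sub (by simp), ?_⟩
      simp [pow_two, hq]
    obtain ⟨c, hc⟩ := IsIntegrallyClosed.algebraMap_eq_of_integral hint
    rw [← hc] at hq hqs
    rw [← map_mul] at hq hqs
    have hcc := IsFractionRing.injective R (FractionRing R) hq
    have hcx := IsFractionRing.injective R (FractionRing R) hqs
    have hc01 : c = 0 ∨ c = 1 := by
      rcases isUnit_or_isUnit_one_sub_self c with hu | hu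
      · right; exact hu.mul_left_injective (by simpa using hcc)
      · left; exact hu.mul_left_injective (by simp only; linear_combination -hcc)
    rcases hc01 with rfl | rfl
    · have hx0 : x = 0 := by simpa using hcx.symm
      rw [hx0, zero_add] at hs0
      exact hne.2 ((mul_left_mem_nonZeroDivisors_eq_zero_iff hs0).1 ((hJ y).1 hy b ((hI b).2 hab)))
    · have hy0 : y = 0 := by linear_combination hcx
      rw [hy0, add_zero] at hs0
      exact hne.1 ((mul_right_mem_nonZeroDivisors_eq_zero_iff hs0).1 ((hI x).1 hx))
  exact NoZeroDivisors.to_isDomain R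

/-- Serre's criterion for normality, in terms of regular pairs. -/
theorem isNormalRing_of_isSerreLocal {R : Type*} [CommRing R] [IsNoetherianRing R]
    (h : ∀ (P : Ideal R) [P.IsPrime], IsSerreLocal (Localization.AtPrime P)) :
    IsNormalRing R := by
  have key : ∀ x : PrimeSpectrum R, IsDomain (Localization.AtPrime x.asIdeal) ∧
      IsIntegrallyClosed (Localization.AtPrime x.asIdeal) := by
    intro x
    have hn : IsNoetherianRing (Localization.AtPrime x.asIdeal) :=
      IsLocalization.isNoetherianRing x.asIdeal.primeCompl _ inferInstance
    have hS : ∀ (P : Ideal (Localization.AtPrime x.asIdeal)) [P.IsPrime],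
        IsSerreLocal (Localization.AtPrime P) := fun P _ =>
      (h (P.comap (algebraMap R _))).of_ringEquiv
        (IsLocalization.localizationLocalizationAtPrimeIsoLocalization
          x.asIdeal.primeCompl P).toRingEquiv
    have h1 := isReduced_of_isSerreLocal hS
    have h2 := isIntegrallyClosed_of_isSerreLocal hS
    exact ⟨isDomain_of_isIntegrallyClosed, h2⟩
  exact ⟨fun x => (key x).1, fun x => (key x).2⟩

end Serre

end TypeD

namespace TypeD

open IsLocalRing nonZeroDivisors

/-! ### Regular pairs in dimension at least two, and their ascent along flat maps -/

section RegularPair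

/-- In a noetherian integrally closed local domain whose maximal ideal is of the form `(a : b)` with
`b ∉ (a)`, the maximal ideal is principal. -/
theorem isPrincipal_maximalIdeal_of_colon {R : Type*} [CommRing R] [IsDomain R] [IsLocalRing R]
    [IsNoetherianRing R] [IsIntegrallyClosed R] {a b : R} (ha₁ : a ∈ maximalIdeal R) (ha₂ : a ≠ 0)
    (hb₂ : ¬ a ∣ b) (hb₃ : ∀ m ∈ maximalIdeal R, a ∣ b * m) :
    ∃ y, maximalIdeal R = Ideal.span {y} := by
  have hb₄ : b ≠ 0 := by rintro rfl; exact hb₂ (dvd_zero _)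
  let K := FractionRing R
  let x : K := algebraMap R K b / algebraMap R K a
  let M := Submodule.map (Algebra.linearMap R K) (maximalIdeal R)
  have ha₃ : algebraMap R K a ≠ 0 := IsFractionRing.to_map_eq_zero_iff.not.mpr ha₂
  -- Put `x = b/a`. If `x` preserves the maximal ideal it is integral by Cayley–Hamilton, so `a ∣
  -- b`, which is excluded. Otherwise `xm` is a unit for some `m` in the maximal ideal, and `m`
  -- generates.
  by_cases hx : ∀ y ∈ M, x * y ∈ M
  · have := isIntegral_of_smul_mem_submodule M ?_ ?_ x hx
    · obtain ⟨y, e⟩ := IsIntegrallyClosed.algebraMap_eq_of_integral this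
      refine (hb₂ ⟨y, ?_⟩).elim
      apply IsFractionRing.injective R K
      rw [map_mul, e, mul_div_cancel₀ _ ha₃]
    · rw [Submodule.ne_bot_iff]; refine ⟨_, ⟨a, ha₁, rfl⟩, ?_⟩
      exact (IsFractionRing.to_map_eq_zero_iff (K := K)).not.mpr ha₂
    · apply Submodule.FG.map; exact IsNoetherian.noetherian _
  · push Not at hx
    obtain ⟨_, ⟨m, hm, rfl⟩, hxm⟩ := hx
    obtain ⟨k, hk⟩ := hb₃ m hm
    have hk' : x * algebraMap R K m = algebraMap R K k := by
      rw [← mul_div_right_comm, ← map_mul, hk, map_mul, mul_div_cancel_left₀ _ ha₃]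
    have hku : IsUnit k := by
      by_contra hku
      exact hxm ⟨k, hku, hk'.symm⟩
    obtain ⟨u, rfl⟩ := hku
    refine ⟨m, le_antisymm (fun z hz => ?_) ?_⟩
    · obtain ⟨l, hl⟩ := hb₃ z hz
      rw [Ideal.mem_span_singleton]
      refine ⟨l * ↑u⁻¹, mul_left_cancel₀ (mul_ne_zero hb₄ ha₂) ?_⟩
      have hu : (u : R) * ↑u⁻¹ = 1 := u.mul_inv
      linear_combination a * hl - a * (l * ↑u⁻¹) * hk - a * a * l * hu
    · rwa [Ideal.span_le, Set.singleton_subset_iff]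

/-- Krull's principal ideal theorem prevents the maximal ideal from being principal, so by the colon
criterion it is not associated to `R/(a)`. Prime avoidance then yields `b` outside every associated
prime of `R/(a)`, that is, regular modulo `a`. -/
theorem hasRegularPair_of_two_le_height {R : Type*} [CommRing R] [IsDomain R] [IsLocalRing R]
    [IsNoetherianRing R] [IsIntegrallyClosed R] (h : 2 ≤ (maximalIdeal R).height) :
    HasRegularPair R := by
  have hprin : ∀ y, maximalIdeal R ≠ Ideal.span {y} := by
    intro y hy
    have h1 : (maximalIdeal R).height ≤ 1 := by
      have := Ideal.height_le_one_of_isPrincipal_of_mem_minimalPrimes (Ideal.span {y})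
        (maximalIdeal R) (by rw [← hy, Ideal.minimalPrimes_eq_subsingleton_self]; rfl)
      exact this
    exact absurd (h.trans h1) (by norm_num)
  obtain ⟨a, ha, ha0⟩ : ∃ a ∈ maximalIdeal R, a ≠ 0 := by
    by_contra! hc
    exact hprin 0 (le_antisymm (fun x hx => by simpa using hc x hx) (by simp))
  have hne : ∀ P ∈ associatedPrimes R (R ⧸ Ideal.span {a}), P ≠ maximalIdeal R := by
    rintro P hP rfl
    rw [AssociatedPrimes.mem_iff, isAssociatedPrime_iff] at hP
    obtain ⟨-, y, hy⟩ := hP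
    obtain ⟨b, rfl⟩ := Ideal.Quotient.mk_surjective y
    have hmem : ∀ r, r ∈ maximalIdeal R ↔ a ∣ b * r := by
      intro r
      rw [hy, Submodule.mem_colon_singleton, ← Ideal.mem_span_singleton,
        ← Ideal.Quotient.eq_zero_iff_mem, Submodule.mem_bot, mul_comm]
      simp [Algebra.smul_def]
    obtain ⟨y, hy⟩ := isPrincipal_maximalIdeal_of_colon ha ha0
      (fun hd => (Ideal.ne_top_iff_one _).1 (maximalIdeal.isMaximal R).ne_top
        ((hmem 1).2 (by simpa using hd))) (fun m hm => (hmem m).1 hm)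
    exact hprin y hy
  obtain ⟨b, hb, hb'⟩ : ∃ b ∈ maximalIdeal R,
      b ∉ ⋃ P ∈ associatedPrimes R (R ⧸ Ideal.span {a}), (P : Set R) := by
    by_contra! hc
    obtain ⟨P, hP, hle⟩ := ((maximalIdeal R).subset_union_prime_finite
      (associatedPrimes.finite R (R ⧸ Ideal.span {a})) (f := id) 0 0
      fun _ h _ _ ↦ IsAssociatedPrime.isPrime h).1 hc
    have := IsAssociatedPrime.isPrime hP
    exact hne P hP ((le_maximalIdeal this.ne_top).antisymm hle)
  rw [biUnion_associatedPrimes_eq_zero_divisors] at hb'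
  refine ⟨a, ha, b, hb, mem_nonZeroDivisors_of_ne_zero ha0, fun x hx => ?_⟩
  by_contra hax
  refine hb' ⟨Ideal.Quotient.mk _ x, ?_, ?_⟩
  · rwa [Ne, Ideal.Quotient.eq_zero_iff_mem, Ideal.mem_span_singleton]
  · rw [Algebra.smul_def, Ideal.Quotient.algebraMap_eq, ← map_mul, Ideal.Quotient.eq_zero_iff_mem,
      Ideal.mem_span_singleton]
    exact hx

/-- The equational criterion of flatness applied to `bx - ay = 0`: the relation comes from relations
over `R`, in each of which `a` divides the coefficient contributing to `x`. -/
theorem dvd_of_flat {R S : Type*} [CommRing R] [CommRing S] [Algebra R S] [Module.Flat R S]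
    {a b : R} (hab : ∀ x, a ∣ b * x → a ∣ x) (x : S)
    (hx : algebraMap R S a ∣ algebraMap R S b * x) : algebraMap R S a ∣ x := by
  obtain ⟨y, hy⟩ := hx
  obtain ⟨k, c, z, hz, hc⟩ := Module.Flat.isTrivialRelation_of_sum_smul_eq_zero
    (R := R) (M := S) (f := ![b, -a]) (x := ![x, y]) (by
      simp [Fin.sum_univ_two, Algebra.smul_def, hy])
  have h0 := hz 0
  simp only [Matrix.cons_val_zero] at h0
  rw [h0]
  refine Finset.dvd_sum fun j _ => ?_
  rw [Algebra.smul_def]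
  refine Dvd.dvd.mul_right (_root_.map_dvd _ (hab _ ⟨c 1 j, ?_⟩)) _
  have := hc j
  simp [Fin.sum_univ_two] at this
  linear_combination this

theorem map_mem_nonZeroDivisors_of_flat {R S : Type*} [CommRing R] [CommRing S] [Algebra R S]
    [Module.Flat R S] {a : R} (ha : a ∈ R⁰) : algebraMap R S a ∈ S⁰ := by
  refine mem_nonZeroDivisors_iff_right.2 fun x hx => ?_
  have := dvd_of_flat (S := S) (a := 0) (b := a) (fun x hx => by
    rw [zero_dvd_iff] at hx ⊢
    exact (mul_left_mem_nonZeroDivisors_eq_zero_iff ha).1 hx) x (by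
    rw [mul_comm, hx]; exact dvd_zero _)
  simpa using this

theorem HasRegularPair.of_flat {R S : Type*} [CommRing R] [IsLocalRing R] [CommRing S]
    [IsLocalRing S] [Algebra R S] [Module.Flat R S] [IsLocalHom (algebraMap R S)]
    (h : HasRegularPair R) : HasRegularPair S := by
  obtain ⟨a, ha, b, hb, har, hab⟩ := h
  have hmem : ∀ x ∈ maximalIdeal R, algebraMap R S x ∈ maximalIdeal S := fun x hx hu =>
    hx (isUnit_of_map_unit (algebraMap R S) x hu)
  exact ⟨algebraMap R S a, hmem a ha, algebraMap R S b, hmem b hb,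
    map_mem_nonZeroDivisors_of_flat har, dvd_of_flat hab⟩

/-- A noetherian flat algebra over a noetherian normal ring is normal if it is normal at all primes
lying over primes of height at most one. -/
theorem isNormalRing_of_flat {A B : Type*} [CommRing A] [IsNoetherianRing A] [IsNormalRing A]
    [CommRing B] [IsNoetherianRing B] [Algebra A B] [Module.Flat A B]
    (h : ∀ (q : Ideal B) [q.IsPrime], (q.under A).height ≤ 1 →
      IsDomain (Localization.AtPrime q) ∧ IsIntegrallyClosed (Localization.AtPrime q)) :
    IsNormalRing B := by
  refine isNormalRing_of_isSerreLocal fun q _ => ?_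
  rcases le_or_gt (q.under A).height 1 with hq | hq
  · exact Or.inl (h q hq)
  · right
    let p := q.under A
    let := Localization.AtPrime.algebraOfLiesOver p q
    have hp1 : IsDomain (Localization.AtPrime p) :=
      IsNormalRing.isDomain_localization (⟨p, inferInstance⟩ : PrimeSpectrum A)
    have hp2 : IsIntegrallyClosed (Localization.AtPrime p) :=
      IsNormalRing.isIntegrallyClosed_localization (⟨p, inferInstance⟩ : PrimeSpectrum A)
    have hp3 : IsNoetherianRing (Localization.AtPrime p) :=
      IsLocalization.isNoetherianRing p.primeCompl _ inferInstance
    have hloc : IsLocalHom (algebraMap (Localization.AtPrime p) (Localization.AtPrime q)) :=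
      Localization.isLocalHom_localRingHom p q _ _
    refine HasRegularPair.of_flat (R := Localization.AtPrime p)
      (hasRegularPair_of_two_le_height ?_)
    have h1 := IsLocalization.AtPrime.ringKrullDim_eq_height p (Localization.AtPrime p)
    rw [← maximalIdeal_height_eq_ringKrullDim] at h1
    rw [WithBot.coe_inj.1 h1]
    exact Order.add_one_le_of_lt hq

end RegularPair

end TypeD

noncomputable section

namespace TypeD

/-! ### Freeness of `A[X,Y]/(Y² - P(X), XY - α)` -/

section Quadric

variable {A : Type*} [CommRing A]

/-- The ideal of `A[X][Y]` generated by `Y² - P(X)` and `XY - α`. -/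
def quadricIdeal (P : A[X]) (α : A) : Ideal A[X][X] :=
  Ideal.span {X ^ 2 - C P, C X * X - C (C α)}

/-- The ring `A[X, Y] / (Y² - P(X), XY - α)`. -/
def Quadric (P : A[X]) (α : A) : Type _ := A[X][X] ⧸ quadricIdeal P α

namespace Quadric

variable (P : A[X]) (α : A)

instance : CommRing (Quadric P α) := inferInstanceAs (CommRing (A[X][X] ⧸ quadricIdeal P α))

/-- The quotient map onto `A[X, Y] / (Y² - P(X), XY - α)`. -/
def mk : A[X][X] →+* Quadric P α := Ideal.Quotient.mk (quadricIdeal P α)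

instance : Algebra A (Quadric P α) := ((mk P α).comp (C.comp C)).toAlgebra

theorem mk_surjective : Function.Surjective (mk P α) := Ideal.Quotient.mk_surjective

theorem mk_eq_zero_iff (z : A[X][X]) : mk P α z = 0 ↔ z ∈ quadricIdeal P α :=
  Ideal.Quotient.eq_zero_iff_mem

theorem mk_C_C (a : A) : mk P α (C (C a)) = algebraMap A _ a := rfl

/-- The class of `X` in `A[X, Y] / (Y² - P(X), XY - α)`. -/
def x : Quadric P α := mk P α (C X)

/-- The class of `Y` in `A[X, Y] / (Y² - P(X), XY - α)`. -/
def y : Quadric P α := mk P α X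

theorem mk_C (p : A[X]) : mk P α (C p) = aeval (x P α) p := by
  have : (mk P α).comp C = (aeval (x P α) : A[X] →ₐ[A] Quadric P α).toRingHom := by
    ext a
    · simp [mk_C_C]
    · simp [x]
  exact congrArg (fun f => f p) this

theorem y_sq : y P α ^ 2 = aeval (x P α) P := by
  rw [← mk_C, y, ← map_pow, ← sub_eq_zero, ← map_sub, mk_eq_zero_iff]
  exact Ideal.subset_span (by simp)

theorem x_mul_y : x P α * y P α = algebraMap A _ α := by
  rw [← mk_C_C, x, y, ← map_mul, ← sub_eq_zero, ← map_sub, mk_eq_zero_iff]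
  exact Ideal.subset_span (by simp)

/-- The linear combinations of `1, x, …, x^d, y`. -/
def coordMap (d : ℕ) : (degreeLT A (d + 1) × A) →ₗ[A] Quadric P α where
  toFun r := aeval (x P α) (r.1 : A[X]) + r.2 • y P α
  map_add' r s := by simp [add_smul]; ring
  map_smul' c r := by simp [mul_smul]

variable {P α}

/-- The range contains 1, so it is enough that it be stable under multiplication by `x` and `y`. The
rewriting rules are `y² = P(x)`, `xy = α` and their consequence `xP(x) = αy`, which lowers
`x^(d+1)`. -/
theorem coordMap_surjective {d : ℕ} (ε : Aˣ) (hP : (C (ε : A) * P).Monic)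
    (hd : (C (ε : A) * P).natDegree = d) : Function.Surjective (coordMap P α d) := by
  set P' := C (ε : A) * P with hP'
  have hPP : P = C (↑ε⁻¹ : A) * P' := by
    rw [hP', ← mul_assoc, ← C_mul]; simp
  have hPdeg : P'.degree < (d + 1 : ℕ) := by
    refine degree_le_natDegree.trans_lt ?_
    rw [hd]; exact_mod_cast Nat.lt_succ_self d
  set W := LinearMap.range (coordMap P α d)
  have hpoly : ∀ p : A[X], p.degree < (d + 1 : ℕ) → aeval (x P α) p ∈ W := fun p hp =>
    ⟨(⟨p, mem_degreeLT.2 hp⟩, 0), by simp [coordMap]⟩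
  have hy : y P α ∈ W := ⟨(0, 1), by simp [coordMap]⟩
  have hone : ∀ a : A, algebraMap A (Quadric P α) a ∈ W := fun a => by
    have := hpoly (C a) (degree_C_le.trans_lt (by exact_mod_cast Nat.succ_pos d))
    simpa using this
  have hxW : ∀ w ∈ W, x P α * w ∈ W := by
    rintro _ ⟨⟨⟨r, hr⟩, c⟩, rfl⟩
    rw [mem_degreeLT] at hr
    simp only [coordMap, LinearMap.coe_mk, AddHom.coe_mk, mul_add, mul_smul_comm, x_mul_y]
    refine add_mem ?_ (W.smul_mem _ (hone α))
    -- The only overflow in `Xr` is its term of degree `d + 1`. It is cancelled by a multiple of the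
    -- monic `XP'`, whose value at `x` is a multiple of `y`.
    have h1 : (X * r - C (r.coeff d) * (X * P')).degree < ((d + 1 : ℕ) : WithBot ℕ) := by
      rw [degree_lt_iff_coeff_zero]
      intro m hm
      obtain ⟨m, rfl⟩ : ∃ k, m = k + 1 := ⟨m - 1, by omega⟩
      rw [coeff_sub, coeff_C_mul, coeff_X_mul, coeff_X_mul]
      rcases eq_or_lt_of_le (Nat.le_of_succ_le_succ hm) with rfl | hlt
      · have := hP.coeff_natDegree
        rw [hd] at this
        rw [this]; simp
      · rw [(degree_lt_iff_coeff_zero _ _).1 hr m hlt,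
          (degree_lt_iff_coeff_zero _ _).1 hPdeg m hlt]; simp
    have h2 : x P α * aeval (x P α) r = aeval (x P α) (X * r - C (r.coeff d) * (X * P')) +
        (r.coeff d * ε * α) • y P α := by
      have h3 : x P α * aeval (x P α) P = algebraMap A _ α * y P α := by
        rw [← y_sq, ← x_mul_y]; ring
      simp only [map_sub, map_mul, aeval_X, aeval_C, hP', Algebra.smul_def]
      linear_combination (algebraMap A (Quadric P α) (r.coeff d) * algebraMap A _ (ε : A)) * h3
    rw [h2]
    exact add_mem (hpoly _ h1) (W.smul_mem _ hy)
  have hyW : ∀ w ∈ W, y P α * w ∈ W := by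
    rintro _ ⟨⟨⟨r, hr⟩, c⟩, rfl⟩
    rw [mem_degreeLT] at hr
    simp only [coordMap, LinearMap.coe_mk, AddHom.coe_mk, mul_add, mul_smul_comm]
    refine add_mem ?_ (W.smul_mem _ ?_)
    · have h1 : y P α * aeval (x P α) r = α • aeval (x P α) r.divX + r.coeff 0 • y P α := by
        conv_lhs => rw [← divX_mul_X_add r]
        simp only [map_add, map_mul, aeval_X, aeval_C, Algebra.smul_def, ← x_mul_y]
        ring
      rw [h1]
      refine add_mem (W.smul_mem _ (hpoly _ (lt_of_le_of_lt ?_ hr))) (W.smul_mem _ hy)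
      rw [degree_le_iff_coeff_zero]
      intro m hm
      rw [coeff_divX]
      exact coeff_eq_zero_of_degree_lt (hm.trans (by exact_mod_cast Nat.lt_succ_self m))
    · have h1 : aeval (x P α) P = (↑ε⁻¹ : A) • aeval (x P α) P' := by
        rw [Algebra.smul_def, ← aeval_C (x P α), ← map_mul, ← hPP]
      rw [← pow_two, y_sq, h1]
      exact W.smul_mem _ (hpoly _ hPdeg)
  have hCW : ∀ p : A[X], ∀ w ∈ W, aeval (x P α) p * w ∈ W := by
    intro p w hw
    induction p using Polynomial.induction_on' with
    | add p q hp hq => rw [map_add, add_mul]; exact add_mem hp hq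
    | monomial k a =>
      rw [aeval_monomial, ← Algebra.smul_def, smul_mul_assoc]
      refine W.smul_mem _ ?_
      induction k with
      | zero => simpa using hw
      | succ k ih => rw [pow_succ', mul_assoc]; exact hxW _ ih
  intro z
  obtain ⟨z, rfl⟩ := mk_surjective P α z
  change _ ∈ W
  induction z using Polynomial.induction_on' with
  | add p q hp hq => rw [map_add]; exact add_mem hp hq
  | monomial k a =>
    rw [← C_mul_X_pow_eq_monomial, map_mul, mk_C, map_pow]
    refine hCW _ _ ?_
    induction k with
    | zero => simpa using hone 1
    | succ k ih => rw [pow_succ']; exact hyW _ ih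

/-- A relation `r + cY = u(Y² - P) + v(XY - α)` allows `v` to be reduced modulo `Y² - P` to `tY +
s`. Comparing coefficients of `Y` gives `c = Xs - αt` and `r = XtP - αs`; eliminating `s` and
counting degrees in `X` forces `t = 0`, then `c = s = r = 0`. -/
theorem coordMap_injective {d : ℕ} (ε : Aˣ) (hP : (C (ε : A) * P).Monic)
    (hd : (C (ε : A) * P).natDegree = d) : Function.Injective (coordMap P α d) := by
  nontriviality A
  set P' := C (ε : A) * P with hP'
  rw [injective_iff_map_eq_zero]
  rintro ⟨⟨r, hr⟩, c⟩ h0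
  rw [mem_degreeLT] at hr
  simp only [coordMap, LinearMap.coe_mk, AddHom.coe_mk] at h0
  have h1 : mk P α (C r + C (C c) * X) = 0 := by
    rw [← h0, map_add, mk_C, map_mul, mk_C, aeval_C, Algebra.smul_def]; rfl
  rw [mk_eq_zero_iff, quadricIdeal, Ideal.mem_span_pair] at h1
  obtain ⟨u, v, huv⟩ := h1
  have hmon : (X ^ 2 - C P : A[X][X]).Monic := monic_X_pow_sub_C P two_ne_zero
  have hdeg2 : (X ^ 2 - C P : A[X][X]).degree = 2 := degree_X_pow_sub_C (by norm_num) P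
  obtain ⟨t, s, hts⟩ : ∃ t s, v %ₘ (X ^ 2 - C P) = C t * X + C s :=
    exists_eq_X_add_C_of_natDegree_le_one (natDegree_le_of_degree_le (by
      have := degree_modByMonic_lt v hmon
      rw [hdeg2] at this
      exact Order.le_of_lt_succ this))
  have hv := modByMonic_add_div v (X ^ 2 - C P)
  have hkey : (X ^ 2 - C P) ∣ C (C c - (X * s - C α * t) : A[X]) * X +
      C (r - (X * t * P - C α * s)) := by
    refine ⟨u + (v /ₘ (X ^ 2 - C P)) * (C X * X - C (C α)) + C (X * t), ?_⟩
    rw [← hv, hts] at huv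
    simp only [map_sub, map_mul]
    linear_combination (-1 : A[X][X]) * huv
  have hz : C (C c - (X * s - C α * t) : A[X]) * X + C (r - (X * t * P - C α * s)) = 0 := by
    by_contra hne
    refine hmon.not_dvd_of_degree_lt hne ?_ hkey
    rw [hdeg2]
    exact degree_linear_lt
  have hc : (C c : A[X]) = X * s - C α * t := by
    have := congrArg (fun p => p.coeff 1) hz
    simpa [sub_eq_zero] using this
  have hr' : r = X * t * P - C α * s := by
    have := congrArg (fun p => p.coeff 0) hz
    simpa [sub_eq_zero] using this
  have hN : (X ^ 2 * P' - C (ε * α ^ 2 : A)).Monic ∧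
      (X ^ 2 * P' - C (ε * α ^ 2 : A)).natDegree = d + 2 := by
    have hm : (X ^ 2 * P').Monic := (monic_X_pow 2).mul hP
    have hm2 : (X ^ 2 * P').natDegree = d + 2 := by
      rw [(monic_X_pow 2).natDegree_mul hP, hd, natDegree_X_pow, add_comm]
    have hlt : (C (ε * α ^ 2 : A)).degree < (X ^ 2 * P').degree := by
      rw [degree_eq_natDegree hm.ne_zero, hm2]
      exact degree_C_le.trans_lt (by exact_mod_cast Nat.succ_pos _)
    refine ⟨hm.sub_of_left hlt, ?_⟩
    rw [natDegree_sub_eq_left_of_natDegree_lt, hm2]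
    rw [hm2, natDegree_C]
    omega
  -- The combination `Xr + αc` eliminates `s`. The left factor is monic of degree `d + 2`, while the
  -- right side has degree at most `d + 1`.
  have htN : (X ^ 2 * P' - C (ε * α ^ 2 : A)) * t = C (ε : A) * (X * r + C (α * c)) := by
    rw [hr', hP']
    simp only [Polynomial.C_mul, Polynomial.C_pow, hc]
    ring
  have ht : t = 0 := by
    have hR : C (ε : A) * (X * r + C (α * c)) = 0 := by
      by_contra hne
      refine hN.1.not_dvd_of_degree_lt hne ?_ ⟨t, htN.symm⟩
      rw [degree_eq_natDegree hN.1.ne_zero, hN.2, degree_lt_iff_coeff_zero]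
      intro m hm
      obtain ⟨m, rfl⟩ : ∃ k, m = k + 1 := ⟨m - 1, by omega⟩
      rw [coeff_C_mul, coeff_add, coeff_X_mul, coeff_C_succ,
        (degree_lt_iff_coeff_zero _ _).1 hr m (by omega)]
      simp
    rw [hR] at htN
    rwa [hN.1.mul_right_eq_zero_iff] at htN
  subst ht
  have hc0 : c = 0 := by
    have := congrArg (fun p => p.coeff 0) hc
    simpa using this
  subst hc0
  have hs : s = 0 := by
    have : X * s = 0 := by simpa using hc.symm
    rwa [monic_X.mul_right_eq_zero_iff] at this
  subst hs
  simp at hr'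
  simp [hr']

theorem free {d : ℕ} (ε : Aˣ) (hP : (C (ε : A) * P).Monic)
    (hd : (C (ε : A) * P).natDegree = d) : Module.Free A (Quadric P α) := by
  have : Module.Free A (degreeLT A (d + 1)) := Module.Free.of_basis (degreeLT.basis A (d + 1))
  exact Module.Free.of_equiv (LinearEquiv.ofBijective (coordMap P α d)
    ⟨coordMap_injective ε hP hd, coordMap_surjective ε hP hd⟩)

/-- The universal property of `A[X, Y] / (Y² - P(X), XY - α)`. -/
def lift {S : Type*} [CommRing S] [Algebra A S] (a b : S) (hb : b ^ 2 = aeval a P)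
    (hab : a * b = algebraMap A S α) : Quadric P α →+* S :=
  Ideal.Quotient.lift (quadricIdeal P α) (eval₂RingHom (aeval a : A[X] →ₐ[A] S).toRingHom b) (by
    intro z hz
    have : quadricIdeal P α ≤ RingHom.ker
        (eval₂RingHom (aeval a : A[X] →ₐ[A] S).toRingHom b) := by
      rw [quadricIdeal, Ideal.span_le]
      rintro _ (rfl | rfl)
      · simp [RingHom.mem_ker, hb]
      · simp [RingHom.mem_ker, hab]
    exact this hz)

section

variable {S : Type*} [CommRing S] [Algebra A S] (a b : S) (hb : b ^ 2 = aeval a P)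
    (hab : a * b = algebraMap A S α)

theorem lift_mk (z : A[X][X]) :
    lift a b hb hab (mk P α z) = eval₂ (aeval a : A[X] →ₐ[A] S).toRingHom b z :=
  Ideal.Quotient.lift_mk _ _ _

theorem lift_x : lift a b hb hab (x P α) = a := by
  simp [x, lift_mk]

theorem lift_y : lift a b hb hab (y P α) = b := by
  simp [y, lift_mk]

theorem lift_algebraMap (c : A) : lift a b hb hab (algebraMap A _ c) = algebraMap A S c := by
  simp [← mk_C_C, lift_mk]

end

theorem ringHom_ext {S : Type*} [CommRing S] {f g : Quadric P α →+* S}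
    (hA : ∀ c, f (algebraMap A _ c) = g (algebraMap A _ c))
    (hx : f (x P α) = g (x P α)) (hy : f (y P α) = g (y P α)) : f = g := by
  have : f.comp (mk P α) = g.comp (mk P α) := by
    ext c
    · exact hA c
    · exact hx
    · exact hy
  ext z
  obtain ⟨z, rfl⟩ := mk_surjective P α z
  exact congrArg (fun f => f z) this

end Quadric

end Quadric

end TypeD

end

noncomputable section

namespace TypeD

universe u

/-! ### The universal property of the type D splitting ring -/

section Universal

variable {A : Type u} [CommRing A]

/-- The elements `eᵢ` of the target of `φ : A → S` satisfy `g(v) = ∏ᵢ (v - eᵢ²)` and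
`∏ᵢ eᵢ = α`. -/
structure IsTypeDRoots {S : Type*} [CommRing S] (φ : A →+* S) {n : ℕ} (g : A[X]) (α : A)
    (e : Fin n → S) : Prop where
  map_eq : g.map φ = ∏ i, (X - C (e i ^ 2))
  prod_eq : ∏ i, e i = φ α

theorem IsTypeDRoots.comp {S T : Type*} [CommRing S] [CommRing T] {φ : A →+* S} {n : ℕ} {g : A[X]}
    {α : A} {e : Fin n → S} (h : IsTypeDRoots φ g α e) (ψ : S →+* T) :
    IsTypeDRoots (ψ.comp φ) g α (fun i => ψ (e i)) where
  map_eq := by rw [← Polynomial.map_map, h.map_eq, Polynomial.map_prod]; simp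
  prod_eq := by rw [← map_prod, h.prod_eq]; rfl

theorem map_splitDiff {S : Type*} [CommRing S] (φ : A →+* S) (n : ℕ) (g : A[X]) (e : Fin n → S) :
    (splitDiff n g).map (MvPolynomial.eval₂Hom φ e) =
      expand S 2 (g.map φ - ∏ i, (X - C (e i ^ 2))) := by
  have h : (MvPolynomial.eval₂Hom φ e).comp MvPolynomial.C = φ := by ext; simp
  simp only [splitDiff, Polynomial.map_sub, Polynomial.map_map, h, Polynomial.map_prod, map_sub,
    map_prod, map_expand]
  simp

variable (n : ℕ) (g : A[X]) (α : A)

theorem isTypeDRoots_etaRoot :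
    IsTypeDRoots (algebraMap A (DSplit n g α)) g α (etaRoot n g α) := by
  have hmk : (Ideal.Quotient.mk (splitIdeal n g α)) =
      MvPolynomial.eval₂Hom (algebraMap A (DSplit n g α)) (etaRoot n g α) := by
    apply MvPolynomial.ringHom_ext
    · intro a; simp; rfl
    · intro i; simp [etaRoot]
  constructor
  · rw [← sub_eq_zero]
    apply expand_injective (R := DSplit n g α) two_pos
    rw [← map_splitDiff, ← hmk, map_zero]
    ext k
    rw [coeff_map, coeff_zero, Ideal.Quotient.eq_zero_iff_mem]
    exact Ideal.subset_span (Or.inl ⟨k, rfl⟩)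
  · have : Ideal.Quotient.mk (splitIdeal n g α)
        (∏ i : Fin n, MvPolynomial.X i - MvPolynomial.C α) = 0 := by
      rw [Ideal.Quotient.eq_zero_iff_mem]
      exact Ideal.subset_span (Or.inr rfl)
    rw [map_sub, map_prod, sub_eq_zero] at this
    exact this

variable {n g α}

/-- The universal property of the type D splitting ring. -/
def DSplit.lift {S : Type*} [CommRing S] {φ : A →+* S} {e : Fin n → S}
    (h : IsTypeDRoots φ g α e) : DSplit n g α →+* S :=
  Ideal.Quotient.lift (splitIdeal n g α) (MvPolynomial.eval₂Hom φ e) (by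
    intro z hz
    have : splitIdeal n g α ≤ RingHom.ker (MvPolynomial.eval₂Hom φ e) := by
      rw [splitIdeal, Ideal.span_le]
      rintro _ (⟨k, rfl⟩ | rfl)
      · have h1 := map_splitDiff φ n g e
        rw [h.map_eq, sub_self, map_zero] at h1
        have h2 := congrArg (fun p => p.coeff k) h1
        simpa using h2
      · have := h.prod_eq
        simp [RingHom.mem_ker, this]
    exact this hz)

theorem DSplit.lift_etaRoot {S : Type*} [CommRing S] {φ : A →+* S} {e : Fin n → S}
    (h : IsTypeDRoots φ g α e) (i : Fin n) : DSplit.lift h (etaRoot n g α i) = e i := by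
  exact (Ideal.Quotient.lift_mk _ _ _).trans (by simp)

theorem DSplit.lift_algebraMap {S : Type*} [CommRing S] {φ : A →+* S} {e : Fin n → S}
    (h : IsTypeDRoots φ g α e) (a : A) : DSplit.lift h (algebraMap A _ a) = φ a := by
  exact (Ideal.Quotient.lift_mk (splitIdeal n g α) _ _).trans (by simp)

theorem DSplit.ringHom_ext {S : Type*} [CommRing S] {f f' : DSplit n g α →+* S}
    (hA : ∀ a, f (algebraMap A _ a) = f' (algebraMap A _ a))
    (he : ∀ i, f (etaRoot n g α i) = f' (etaRoot n g α i)) : f = f' := by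
  apply Ideal.Quotient.ringHom_ext
  apply MvPolynomial.ringHom_ext
  · exact hA
  · exact he

end Universal

/-! ### Flatness by splitting off one root -/

section Flat

/-- For `h = (X - w)k`, evaluation at `w` gives only `w · h.divX(w) = w · k(0)`. As `w` may be a
zero divisor, the polynomial identity is established first by cancelling `X`. -/
theorem divX_X_sub_C_mul {R : Type*} [CommRing R] (w : R) (k : R[X]) :
    ((X - C w) * k).divX.eval w = k.coeff 0 := by
  have h1 : X * ((X - C w) * k).divX + C (-(w * k.coeff 0)) = (X - C w) * k := by
    conv_rhs => rw [← X_mul_divX_add ((X - C w) * k)]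
    simp
  have h2 : X * k.divX + C (k.coeff 0) = k := X_mul_divX_add k
  have h3 : ((X - C w) * k).divX = k - C w * k.divX := by
    refine monic_X.isRegular.left ?_
    simp only
    rw [C_neg, C_mul] at h1
    linear_combination h1 + C w * h2
  have h4 := congrArg (eval w) h2
  rw [eval_add, eval_mul, eval_X, eval_C] at h4
  rw [h3, eval_sub, eval_mul, eval_C]
  linear_combination -h4

theorem coeff_zero_prod {R : Type*} [CommRing R] {m : ℕ} (e : Fin m → R) :
    (∏ i, (X - C (e i ^ 2)) : R[X]).coeff 0 = (-1) ^ m * (∏ i, e i) ^ 2 := by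
  rw [coeff_zero_eq_eval_zero, eval_prod]
  simp [Finset.prod_neg, Finset.prod_pow]

theorem flat_dSplit_zero {A : Type u} [CommRing A] (h2 : IsUnit (2 : A)) (g : A[X]) (hg : g.Monic)
    (hgn : g.natDegree = 0) (α : A) (hα : α ^ 2 = (-1) ^ 0 * g.coeff 0) :
    Module.Flat A (DSplit 0 g α) := by
  obtain ⟨t, ht⟩ := h2.exists_right_inv
  have hg1 : g = 1 := eq_one_of_monic_natDegree_zero hg hgn
  subst hg1
  have hα : α ^ 2 = 1 := by simpa using hα
  -- In rank zero the ring is `A/(1 - α)` with `α² = 1`. Here `e = (1 + α)/2` is killed by `1 - α`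
  -- and maps to 1 in the quotient, so multiplication by `e` exhibits the quotient as a retract of
  -- `A`.
  set e := (1 + α) * t
  have he : e * (1 - α) = 0 := by simp only [e]; linear_combination (-t) * hα
  let ev : MvPolynomial (Fin 0) A →ₗ[A] A :=
    LinearMap.mulLeft A e ∘ₗ (MvPolynomial.aeval (fun i : Fin 0 => i.elim0)).toLinearMap
  have hev : (splitIdeal 0 1 α).restrictScalars A ≤ LinearMap.ker ev := by
    intro z hz
    rw [Submodule.restrictScalars_mem, splitIdeal] at hz
    induction hz using Submodule.span_induction with
    | mem z hz =>
      rcases hz with ⟨k, rfl⟩ | rfl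
      · simp [splitDiff]
      · simpa [ev] using he
    | zero => simp
    | add y z _ _ hy hz => exact add_mem hy hz
    | smul c z _ hz =>
      simp only [ev, LinearMap.mem_ker, LinearMap.comp_apply, AlgHom.toLinearMap_apply,
        LinearMap.mulLeft_apply, smul_eq_mul, map_mul] at hz ⊢
      linear_combination (MvPolynomial.aeval (fun i : Fin 0 => i.elim0) c : A) * hz
  let i : DSplit 0 1 α →ₗ[A] A := Submodule.liftQ ((splitIdeal 0 1 α).restrictScalars A) ev hev
  let r : A →ₗ[A] DSplit 0 1 α := Algebra.linearMap A _
  refine Module.Flat.of_retract i r (LinearMap.ext fun z => ?_)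
  obtain ⟨z, rfl⟩ := Ideal.Quotient.mk_surjective z
  obtain ⟨a, rfl⟩ := MvPolynomial.C_surjective (Fin 0) z
  have hi : i (Ideal.Quotient.mk _ (MvPolynomial.C a)) = e * a := by
    change ev (MvPolynomial.C a) = _
    simp [ev]
  have h1 : algebraMap A (DSplit 0 1 α) α = 1 := by
    simpa using (isTypeDRoots_etaRoot 0 1 α).prod_eq.symm
  have h3 : algebraMap A (DSplit 0 1 α) e = 1 := by
    have := congrArg (algebraMap A (DSplit 0 1 α)) ht
    simp only [map_mul, map_ofNat, map_one] at this
    simp only [e, map_mul, map_add, map_one, h1]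
    linear_combination this
  change algebraMap A (DSplit 0 1 α) (i (Ideal.Quotient.mk _ (MvPolynomial.C a))) = _
  rw [hi, map_mul, h3, one_mul]
  rfl

variable {A : Type u} [CommRing A]

/-- The polynomial `± (g(X²) - g(0)) / X²`. -/
def residualPoly (m : ℕ) (g : A[X]) : A[X] := C ((-1) ^ m) * expand A 2 g.divX

/-- The quotient of `g` by `v - x²`, over the ring generated by a first root `x` and the product `y`
of the other roots. -/
def residualFactor (m : ℕ) (g : A[X]) (α : A) : (Quadric (residualPoly m g) α)[X] :=
  g.map (algebraMap A _) /ₘ (X - C (Quadric.x (residualPoly m g) α ^ 2))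

section

variable {m : ℕ} {g : A[X]} {α : A}

theorem natDegree_divX_of_monic (hg : g.Monic) (hgn : g.natDegree = m + 1) :
    g.divX.Monic ∧ g.divX.natDegree = m := by
  have h1 : g.divX.natDegree = m := by rw [natDegree_divX_eq_natDegree_tsub_one, hgn]; rfl
  refine ⟨?_, h1⟩
  rw [Monic, leadingCoeff, h1, coeff_divX, ← hgn]
  exact hg.coeff_natDegree

theorem free_quadric_residualPoly (hg : g.Monic) (hgn : g.natDegree = m + 1) :
    Module.Free A (Quadric (residualPoly m g) α) := by
  -- The unit `ε` in the freeness lemma is this sign, which makes `P` monic of degree `2m`.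
  have h : C (((-1) ^ m : Aˣ) : A) * residualPoly m g = expand A 2 g.divX := by
    rw [residualPoly, ← mul_assoc, ← C_mul]
    simp [← mul_pow]
  exact Quadric.free (d := m * 2) ((-1) ^ m) (by
    rw [h]; exact (natDegree_divX_of_monic hg hgn).1.expand two_pos) (by
    rw [h, natDegree_expand, (natDegree_divX_of_monic hg hgn).2])

theorem aeval_residualPoly {S : Type*} [CommRing S] [Algebra A S] (a : S) :
    aeval a (residualPoly m g) = (-1) ^ m * aeval (a ^ 2) g.divX := by
  simp [residualPoly, expand_aeval]

theorem X_sub_C_mul_residualFactor (hα : α ^ 2 = (-1) ^ (m + 1) * g.coeff 0) :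
    (X - C (Quadric.x (residualPoly m g) α ^ 2)) * residualFactor m g α =
      g.map (algebraMap A _) := by
  rw [residualFactor, mul_divByMonic_eq_iff_isRoot, IsRoot, eval_map_algebraMap]
  have h1 := Quadric.y_sq (residualPoly m g) α
  rw [aeval_residualPoly] at h1
  have h2 := Quadric.x_mul_y (residualPoly m g) α
  have h3 := congrArg (aeval (Quadric.x (residualPoly m g) α ^ 2)) (X_mul_divX_add g)
  have h4 := congrArg (algebraMap A (Quadric (residualPoly m g) α)) hα
  have h5 : ((-1 : Quadric (residualPoly m g) α) ^ m) * (-1) ^ m = 1 := by simp [← mul_pow]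
  simp only [map_add, map_mul, aeval_X, aeval_C, map_pow, map_neg, map_one] at h3 h4
  rw [← h3, ← h2] at *
  generalize aeval (Quadric.x (residualPoly m g) α ^ 2) g.divX = D at *
  generalize Quadric.x (residualPoly m g) α = x at *
  generalize Quadric.y (residualPoly m g) α = y at *
  generalize algebraMap A (Quadric (residualPoly m g) α) (g.coeff 0) = g0 at *
  rw [pow_succ (-1)] at h4
  generalize (-1 : Quadric (residualPoly m g) α) ^ m = s at *
  linear_combination s * h4 - s * x ^ 2 * h1 - (x ^ 2 * D + g0) * h5

theorem residualFactor_monic (hg : g.Monic) (hα : α ^ 2 = (-1) ^ (m + 1) * g.coeff 0) :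
    (residualFactor m g α).Monic :=
  (monic_X_sub_C _).of_mul_monic_left (by
    rw [X_sub_C_mul_residualFactor hα]; exact hg.map _)

/-- The constant term condition for the residual pair, needed to apply the induction hypothesis to
it. This is what dictates the choice of `P`. -/
theorem y_sq_eq (hα : α ^ 2 = (-1) ^ (m + 1) * g.coeff 0) :
    Quadric.y (residualPoly m g) α ^ 2 = (-1) ^ m * (residualFactor m g α).coeff 0 := by
  rw [Quadric.y_sq, aeval_residualPoly, ← divX_X_sub_C_mul, X_sub_C_mul_residualFactor hα,
    ← eval_map_algebraMap]
  congr 2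
  ext k
  simp [coeff_divX]

theorem natDegree_residualFactor [Nontrivial (Quadric (residualPoly m g) α)] (hg : g.Monic)
    (hgn : g.natDegree = m + 1) : (residualFactor m g α).natDegree = m := by
  rw [residualFactor, natDegree_divByMonic _ (monic_X_sub_C _), hg.natDegree_map, hgn,
    natDegree_X_sub_C]
  rfl

variable (m g α) in
/-- The type D splitting ring of rank `m` obtained by splitting off a first root. -/
abbrev ResidualSplit : Type u :=
  DSplit m (residualFactor m g α) (Quadric.y (residualPoly m g) α)

theorem isTypeDRoots_residual (hα : α ^ 2 = (-1) ^ (m + 1) * g.coeff 0) :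
    IsTypeDRoots (algebraMap A (ResidualSplit m g α)) g α
      (Fin.cons (algebraMap _ (ResidualSplit m g α) (Quadric.x (residualPoly m g) α))
        (etaRoot m (residualFactor m g α) (Quadric.y (residualPoly m g) α))) := by
  have h := isTypeDRoots_etaRoot m (residualFactor m g α) (Quadric.y (residualPoly m g) α)
  have hφ : algebraMap A (ResidualSplit m g α) =
      (algebraMap (Quadric (residualPoly m g) α) (ResidualSplit m g α)).comp (algebraMap A _) :=
    IsScalarTower.algebraMap_eq _ _ _
  constructor
  · rw [hφ, ← Polynomial.map_map, ← X_sub_C_mul_residualFactor hα, Polynomial.map_mul, h.map_eq,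
      Fin.prod_univ_succ]
    simp
  · rw [Fin.prod_univ_succ, hφ]
    simp only [Fin.cons_zero, Fin.cons_succ, RingHom.comp_apply]
    rw [h.prod_eq, ← map_mul, Quadric.x_mul_y]

theorem IsTypeDRoots.sq_prod_succ {S : Type*} [CommRing S] [Algebra A S] {e : Fin (m + 1) → S}
    (h : IsTypeDRoots (algebraMap A S) g α e) :
    (∏ i : Fin m, e i.succ) ^ 2 = aeval (e 0) (residualPoly m g) := by
  have h0 := h.map_eq
  rw [Fin.prod_univ_succ] at h0
  have h1 := divX_X_sub_C_mul (e 0 ^ 2) (∏ i : Fin m, (X - C (e i.succ ^ 2)))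
  rw [← h0, coeff_zero_prod] at h1
  have h2 : (g.map (algebraMap A S)).divX = g.divX.map (algebraMap A S) := by
    ext k; simp [coeff_divX]
  rw [h2, eval_map_algebraMap] at h1
  rw [aeval_residualPoly, h1, ← mul_assoc, ← mul_pow]
  simp

variable (m g α) in
/-- The map from the ring generated by a first root and the product of the others. -/
def quadricToDSplit :
    Quadric (residualPoly m g) α →+* DSplit (m + 1) g α :=
  Quadric.lift (etaRoot (m + 1) g α 0) (∏ i : Fin m, etaRoot (m + 1) g α i.succ)
    (isTypeDRoots_etaRoot (m + 1) g α).sq_prod_succ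
    (by rw [← Fin.prod_univ_succ, (isTypeDRoots_etaRoot (m + 1) g α).prod_eq])

theorem quadricToDSplit_algebraMap (a : A) :
    quadricToDSplit m g α (algebraMap A _ a) = algebraMap A _ a :=
  Quadric.lift_algebraMap _ _ _ _ a

theorem isTypeDRoots_quadricToDSplit (hα : α ^ 2 = (-1) ^ (m + 1) * g.coeff 0) :
    IsTypeDRoots (quadricToDSplit m g α) (residualFactor m g α)
      (Quadric.y (residualPoly m g) α) (fun i => etaRoot (m + 1) g α i.succ) := by
  constructor
  · refine (monic_X_sub_C (etaRoot (m + 1) g α 0 ^ 2)).isRegular.left ?_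
    have h1 := congrArg (Polynomial.map (quadricToDSplit m g α))
      (X_sub_C_mul_residualFactor hα)
    have h2 : (quadricToDSplit m g α).comp (algebraMap A _) = algebraMap A _ :=
      RingHom.ext fun a => quadricToDSplit_algebraMap a
    have hx : quadricToDSplit m g α (Quadric.x _ _) = etaRoot (m + 1) g α 0 :=
      Quadric.lift_x _ _ _ _
    rw [Polynomial.map_mul, Polynomial.map_map, h2, (isTypeDRoots_etaRoot (m + 1) g α).map_eq,
      Fin.prod_univ_succ, Polynomial.map_sub, map_X, map_C, map_pow, hx] at h1
    exact h1
  · exact (Quadric.lift_y _ _ _ _).symm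

/-- Splitting off a first root. -/
def dSplitEquiv (hα : α ^ 2 = (-1) ^ (m + 1) * g.coeff 0) :
    DSplit (m + 1) g α ≃ₐ[A] ResidualSplit m g α :=
  AlgEquiv.ofRingEquiv (f := RingEquiv.ofRingHom (DSplit.lift (isTypeDRoots_residual hα))
    (DSplit.lift (isTypeDRoots_quadricToDSplit hα))
    (by
      apply DSplit.ringHom_ext
      · refine fun z => congrArg (fun f : Quadric (residualPoly m g) α →+* _ => f z)
          (Quadric.ringHom_ext (f := ((DSplit.lift (isTypeDRoots_residual hα)).comp
            (DSplit.lift (isTypeDRoots_quadricToDSplit hα))).comp (algebraMap _ _))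
            (g := (RingHom.id _).comp (algebraMap _ _)) (fun a => ?_) ?_ ?_)
        · simp only [RingHom.comp_apply, DSplit.lift_algebraMap, quadricToDSplit_algebraMap]
          rw [IsScalarTower.algebraMap_apply A (Quadric (residualPoly m g) α)]
          rfl
        · simp only [RingHom.comp_apply, DSplit.lift_algebraMap, quadricToDSplit, Quadric.lift_x,
            DSplit.lift_etaRoot, Fin.cons_zero]
          rfl
        · simp only [RingHom.comp_apply, DSplit.lift_algebraMap, quadricToDSplit, Quadric.lift_y,
            map_prod, DSplit.lift_etaRoot, Fin.cons_succ]
          exact (isTypeDRoots_etaRoot _ _ _).prod_eq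
      · intro i
        simp only [RingHom.comp_apply, DSplit.lift_etaRoot, Fin.cons_succ]
        rfl)
    (by
      apply DSplit.ringHom_ext
      · intro a
        simp only [RingHom.comp_apply, DSplit.lift_algebraMap]
        rw [IsScalarTower.algebraMap_apply A (Quadric (residualPoly m g) α),
          DSplit.lift_algebraMap, quadricToDSplit_algebraMap]
        rfl
      · intro i
        refine Fin.cases ?_ (fun i => ?_) i
        · simp only [RingHom.comp_apply, DSplit.lift_etaRoot, Fin.cons_zero,
            DSplit.lift_algebraMap, quadricToDSplit, Quadric.lift_x]
          rfl
        · simp only [RingHom.comp_apply, DSplit.lift_etaRoot, Fin.cons_succ]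
          rfl))
    (fun a => DSplit.lift_algebraMap (isTypeDRoots_residual hα) a)

end

/-- The type D splitting ring is flat. -/
theorem flat_dSplit (n : ℕ) : ∀ {A : Type u} [CommRing A] (_ : IsUnit (2 : A)) (g : A[X])
    (_ : g.Monic) (_ : g.natDegree = n) (α : A) (_ : α ^ 2 = (-1) ^ n * g.coeff 0),
    Module.Flat A (DSplit n g α) := by
  induction n with
  | zero => exact fun h2 g hg hgn α hα => flat_dSplit_zero h2 g hg hgn α hα
  | succ m ih =>
    intro A _ h2 g hg hgn α hα
    -- Over the zero ring the residual factor does not have degree `m`, so that case is treated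
    -- apart.
    rcases subsingleton_or_nontrivial (Quadric (residualPoly m g) α) with hS | hS
    · have h1 : Subsingleton (ResidualSplit m g α) :=
        (algebraMap (Quadric (residualPoly m g) α) (ResidualSplit m g α)).codomain_trivial
      have := (dSplitEquiv hα).toEquiv.subsingleton
      infer_instance
    · have h1 := ih (A := Quadric (residualPoly m g) α)
        (by rw [← map_ofNat (algebraMap A (Quadric (residualPoly m g) α)) 2]; exact h2.map _)
        (residualFactor m g α) (residualFactor_monic hg hα) (natDegree_residualFactor hg hgn)
        (Quadric.y (residualPoly m g) α) (y_sq_eq hα)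
      have h3 := free_quadric_residualPoly (α := α) hg hgn
      have h4 : Module.Flat A (ResidualSplit m g α) :=
        Module.Flat.trans A (Quadric (residualPoly m g) α) _
      exact Module.Flat.of_linearEquiv (dSplitEquiv hα).toLinearEquiv

end Flat

end TypeD

end

namespace TypeD

/-! ### Discriminants and double vanishing -/

section Discriminant

/-- The resultant is taken with formal degree `g.natDegree - 1` for the derivative, whose actual
degree can drop; only then does it commute with base change. -/
theorem resultant_derivative_eq {R : Type*} [CommRing R] [Nontrivial R] {g : R[X]} (hg : g.Monic)
    (h0 : g.natDegree ≠ 0) :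
    resultant g g.derivative g.natDegree (g.natDegree - 1) =
      (-1) ^ (g.natDegree * (g.natDegree - 1) / 2) * g.discr := by
  rw [resultant_deriv (natDegree_pos_iff_degree_pos.1 (Nat.pos_of_ne_zero h0)), hg.leadingCoeff,
    mul_one]

theorem map_discr_of_monic {R S : Type*} [CommRing R] [CommRing S] (φ : R →+* S) {g : R[X]}
    (hg : g.Monic) : φ g.discr = (g.map φ).discr := by
  nontriviality S
  have := φ.domain_nontrivial
  by_cases h0 : g.natDegree = 0
  · rw [eq_one_of_monic_natDegree_zero hg h0, Polynomial.map_one, ← C_1, ← C_1, discr_C, discr_C,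
      map_one]
  have h1 := congrArg φ (resultant_derivative_eq hg h0)
  have h2 := resultant_derivative_eq (hg.map φ) (by rwa [hg.natDegree_map])
  rw [← resultant_map_map, ← derivative_map] at h1
  rw [hg.natDegree_map, h1, map_mul, map_pow, map_neg, map_one] at h2
  exact ((isUnit_one.neg).pow _).mul_left_cancel h2

/-- The discriminant of a monic polynomial vanishes wherever the polynomial acquires a double
root. -/
theorem map_discr_eq_zero {R S : Type*} [CommRing R] [CommRing S] (φ : R →+* S) {g : R[X]}
    (hg : g.Monic) (w : S) (h : (X - C w) ^ 2 ∣ g.map φ) : φ g.discr = 0 := by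
  nontriviality S
  have := φ.domain_nontrivial
  obtain ⟨k, hk⟩ := h
  have h1 : (g.map φ).eval w = 0 := by rw [hk]; simp
  have h2 : (g.map φ).derivative.eval w = 0 := by
    rw [hk, pow_two, mul_assoc]
    simp [derivative_mul]
  have h0 : g.natDegree ≠ 0 := by
    intro h0
    rw [eq_one_of_monic_natDegree_zero hg h0] at h1
    simp at h1
  have h3 := congrArg φ (resultant_derivative_eq hg h0)
  rw [← resultant_map_map, ← derivative_map] at h3
  obtain ⟨p, q, -, -, hpq⟩ := exists_mul_add_mul_eq_C_resultant (m := g.natDegree)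
    (n := g.natDegree - 1) (g.map φ) (g.map φ).derivative natDegree_map_le
    ((natDegree_derivative_le _).trans (Nat.sub_le_sub_right natDegree_map_le 1)) (Or.inl h0)
  have h4 := congrArg (eval w) hpq
  rw [eval_add, eval_mul, eval_mul, h1, h2, eval_C, h3, map_mul, map_pow, map_neg, map_one] at h4
  have h5 : IsUnit ((-1 : S) ^ (g.natDegree * (g.natDegree - 1) / 2)) := (isUnit_one.neg).pow _
  rw [zero_mul, zero_mul, add_zero, eq_comm, h5.mul_right_eq_zero] at h4
  exact h4

/-- A square matrix over a field whose kernel has dimension at least two has vanishing adjugate. -/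
theorem adjugate_eq_zero_of_linearIndependent {K ι : Type*} [Field K] [Fintype ι] [DecidableEq ι]
    (M : Matrix ι ι K) (u v : ι → K) (hu : M.mulVec u = 0) (hv : M.mulVec v = 0)
    (huv : LinearIndependent K ![u, v]) : M.adjugate = 0 := by
  ext i j
  rw [Matrix.adjugate_apply, Matrix.zero_apply, ← Matrix.exists_mulVec_eq_zero_iff]
  rw [LinearIndependent.pair_iff] at huv
  -- A cofactor is the determinant with row `j` replaced by the `i`-th unit vector. A
  -- two-dimensional kernel contains a nonzero vector with vanishing `i`-th coordinate, which also
  -- kills the modified matrix.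
  have key : ∀ a b : K, (a ≠ 0 ∨ b ≠ 0) → a * u i + b * v i = 0 →
      ∃ z, z ≠ 0 ∧ (M.updateRow j (Pi.single i 1)).mulVec z = 0 := by
    intro a b hab h0
    refine ⟨a • u + b • v, fun h => ?_, ?_⟩
    · obtain ⟨rfl, rfl⟩ := huv a b h
      simp at hab
    · have hM : M.mulVec (a • u + b • v) = 0 := by
        rw [Matrix.mulVec_add, Matrix.mulVec_smul, Matrix.mulVec_smul, hu, hv]; simp
      ext l
      rcases eq_or_ne l j with rfl | hl
      · simpa [Matrix.mulVec] using h0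
      · have := congrFun hM l
        simpa [Matrix.mulVec, Matrix.updateRow_ne hl] using this
  by_cases h : v i = 0
  · exact key 0 1 (by simp) (by simp [h])
  · exact key (v i) (-u i) (Or.inl h) (by ring)

/-- With `f = HF` and `g = HG`, the pairs `(-F, G)` and `(-XF, XG)` are independent elements of the
kernel of the Sylvester map; `H` having degree at least two leaves room for the factor `X`. -/
theorem adjugate_sylvester_eq_zero {K : Type*} [Field K] {f g H : K[X]} {m n : ℕ} (hf0 : f ≠ 0)
    (hf : f.natDegree ≤ m) (hg : g.natDegree ≤ n) (hH : 2 ≤ H.natDegree) (hHf : H ∣ f)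
    (hHg : H ∣ g) : (sylvester f g m n).adjugate = 0 := by
  obtain ⟨F, rfl⟩ := hHf
  obtain ⟨G, rfl⟩ := hHg
  have hH0 : H ≠ 0 := left_ne_zero_of_mul hf0
  have hF0 : F ≠ 0 := right_ne_zero_of_mul hf0
  rw [natDegree_mul hH0 hF0] at hf
  have hmemF : ∀ k ≤ 1, (X ^ k * F) ∈ degreeLT K m := by
    intro k hk
    rw [mem_degreeLT]
    refine (degree_lt_iff_coeff_zero _ _).2 fun l hl => ?_
    refine coeff_eq_zero_of_natDegree_lt (lt_of_lt_of_le ?_ hl)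
    rw [natDegree_mul (pow_ne_zero _ X_ne_zero) hF0, natDegree_X_pow]
    omega
  have hmemG : ∀ k ≤ 1, (X ^ k * G) ∈ degreeLT K n := by
    intro k hk
    rcases eq_or_ne G 0 with rfl | hG0
    · simp
    rw [natDegree_mul hH0 hG0] at hg
    rw [mem_degreeLT]
    refine (degree_lt_iff_coeff_zero _ _).2 fun l hl => ?_
    refine coeff_eq_zero_of_natDegree_lt (lt_of_lt_of_le ?_ hl)
    rw [natDegree_mul (pow_ne_zero _ X_ne_zero) hG0, natDegree_X_pow]
    omega
  have hf' : (H * F).natDegree ≤ m := by rwa [natDegree_mul hH0 hF0]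
  let b₁ := ((degreeLT.basis K m).prod (degreeLT.basis K n)).reindex finSumFinEquiv
  let b₂ := degreeLT.basis K (m + n)
  let z : ∀ k ≤ 1, degreeLT K m × degreeLT K n := fun k hk =>
    (-⟨X ^ k * F, hmemF k hk⟩, ⟨X ^ k * G, hmemG k hk⟩)
  have hz : ∀ k hk, (sylvester (H * F) (H * G) m n).mulVec (b₁.repr (z k hk)) = 0 := by
    intro k hk
    rw [← toMatrix_sylvesterMap' _ _ hf' hg, LinearMap.toMatrix_mulVec_repr]
    have : sylvesterMap (H * F) (H * G) hf' hg (z k hk) = 0 := by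
      ext1
      simp [z]
      ring
    rw [this]; simp
  refine adjugate_eq_zero_of_linearIndependent _ _ _ (hz 0 (by norm_num)) (hz 1 le_rfl) ?_
  rw [LinearIndependent.pair_iff]
  intro s t hst
  have h1 : s • z 0 (by norm_num) + t • z 1 le_rfl = 0 := by
    apply b₁.repr.injective
    ext i
    have := congrFun hst i
    simpa using this
  have h2 := congrArg (fun p => ((p.1 : degreeLT K m) : K[X])) h1
  have h3 : (C s + C t * X) * F = 0 := by
    simp [z, smul_eq_C_mul] at h2
    linear_combination -h2
  have h4 : C s + C t * X = 0 := (mul_eq_zero.1 h3).resolve_right hF0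
  exact ⟨by simpa using congrArg (fun p => p.coeff 0) h4,
    by simpa using congrArg (fun p => p.coeff 1) h4⟩

variable {O : Type*} [CommRing O] [IsDomain O] [IsDiscreteValuationRing O]

/-- From `det (adj M) = (det M)^(r-1)` one gets `r ≤ (r - 1) v(det M)`, so the valuation cannot be 0
or 1. -/
theorem sq_dvd_det_of_dvd_adjugate {ι : Type*} [Fintype ι] [DecidableEq ι] {π : O}
    (hπ : Irreducible π) (M : Matrix ι ι O) (hι : 2 ≤ Fintype.card ι)
    (h : ∀ i j, π ∣ M.adjugate i j) : π ^ 2 ∣ M.det := by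
  choose N hN using h
  have h1 : M.adjugate = π • Matrix.of N := by
    ext i j; simp [hN]
  have h2 := Matrix.det_adjugate M
  rw [h1, Matrix.det_smul] at h2
  rcases eq_or_ne M.det 0 with h0 | h0
  · rw [h0]; exact dvd_zero _
  obtain ⟨k, u, hk⟩ := IsDiscreteValuationRing.eq_unit_mul_pow_irreducible h0 hπ
  have h3 : π ^ Fintype.card ι ∣ π ^ (k * (Fintype.card ι - 1)) := by
    have : π ^ Fintype.card ι ∣ M.det ^ (Fintype.card ι - 1) := ⟨_, h2.symm⟩
    rw [hk, mul_pow, ← pow_mul] at this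
    exact (u.isUnit.pow _).dvd_mul_left.1 this
  rw [pow_dvd_pow_iff hπ.ne_zero hπ.not_isUnit] at h3
  rw [hk]
  refine Dvd.dvd.mul_left (pow_dvd_pow π ?_) _
  by_contra hlt
  have : k ≤ 1 := by omega
  have := Nat.mul_le_mul_right (Fintype.card ι - 1) this
  omega

/-- If the reduction of a monic polynomial over a discrete valuation ring has a factor of degree at
least two in common with its derivative, possibly after an extension of the residue field, then
its discriminant vanishes to order two. -/
theorem sq_dvd_discr {π : O} (hπ : Irreducible π) {g : O[X]} (hg : g.Monic) {L : Type*} [Field L]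
    (φ : O →+* L) (hφ : ∀ a, φ a = 0 → π ∣ a) {H : L[X]} (hH : 2 ≤ H.natDegree)
    (h1 : H ∣ g.map φ) (h2 : H ∣ (g.map φ).derivative) : π ^ 2 ∣ g.discr := by
  have hdeg : 2 ≤ g.natDegree := by
    rw [← hg.natDegree_map φ]
    exact hH.trans (natDegree_le_of_dvd h1 (hg.map φ).ne_zero)
  have h3 := resultant_derivative_eq hg (by omega)
  have h4 : π ^ 2 ∣ resultant g g.derivative g.natDegree (g.natDegree - 1) := by
    refine sq_dvd_det_of_dvd_adjugate hπ _ (by simp; omega) fun i j => hφ _ ?_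
    have h5 := φ.map_adjugate (sylvester g g.derivative g.natDegree (g.natDegree - 1))
    rw [← sylvester_map_map, ← derivative_map, adjugate_sylvester_eq_zero (hg.map φ).ne_zero
      natDegree_map_le
      ((natDegree_derivative_le _).trans (Nat.sub_le_sub_right natDegree_map_le 1)) hH h1 h2] at h5
    exact congrFun (congrFun h5 i) j
  rw [h3] at h4
  have h5 : IsUnit ((-1 : O) ^ (g.natDegree * (g.natDegree - 1) / 2)) := (isUnit_one.neg).pow _
  exact h5.dvd_mul_left.1 h4

theorem X_sub_C_mul_dvd_derivative {L : Type*} [CommRing L] {F : L[X]} (r s : L)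
    (h : ((X - C r) ^ 2 * (X - C s) ^ 2 ∣ F) ∨ (r = s ∧ (X - C r) ^ 3 ∣ F)) :
    (X - C r) * (X - C s) ∣ F ∧ (X - C r) * (X - C s) ∣ F.derivative := by
  rcases h with ⟨E, rfl⟩ | ⟨rfl, E, rfl⟩
  · refine ⟨⟨(X - C r) * (X - C s) * E, by ring⟩, ⟨2 * (X - C s) * E + 2 * (X - C r) * E +
      (X - C r) * (X - C s) * derivative E, ?_⟩⟩
    simp [derivative_mul, derivative_pow, show (C 2 : L[X]) = 2 from map_ofNat C 2]
    ring
  · refine ⟨⟨(X - C r) * E, by ring⟩, ⟨3 * E + (X - C r) * derivative E, ?_⟩⟩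
    simp [derivative_mul, derivative_pow, show (C 3 : L[X]) = 3 from map_ofNat C 3]
    ring

/-- Two distinct pairs are either disjoint, giving two squared factors, or share an index, giving a
cube. In both cases the product of the two linear factors divides the polynomial and its derivative.
-/
theorem double_dvd_of_two_pairs {L : Type*} [CommRing L] {n : ℕ} (w : Fin n → L) {i j k l : Fin n}
    (hij : i < j) (hkl : k < l) (hne : (i, j) ≠ (k, l)) (h1 : w i = w j) (h2 : w k = w l) :
    ((X - C (w i)) ^ 2 * (X - C (w k)) ^ 2 ∣ ∏ a, (X - C (w a))) ∨
      (w i = w k ∧ (X - C (w i)) ^ 3 ∣ ∏ a, (X - C (w a))) := by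
  have triple : ∀ a b c : Fin n, a ≠ b → a ≠ c → b ≠ c → w a = w b → w a = w c →
      (X - C (w a)) ^ 3 ∣ ∏ a, (X - C (w a)) := by
    intro a b c hab hac hbc hwb hwc
    have := Finset.prod_dvd_prod_of_subset {a, b, c} Finset.univ (fun a => X - C (w a))
      (Finset.subset_univ _)
    rw [Finset.prod_insert (by simp [hab, hac]), Finset.prod_pair hbc, ← hwb, ← hwc] at this
    convert this using 1
    ring
  by_cases hik : i = k
  · subst hik
    have hjl : j ≠ l := fun h => hne (by rw [h])
    exact Or.inr ⟨rfl, triple i j l hij.ne hkl.ne hjl h1 h2⟩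
  by_cases hil : i = l
  · subst hil
    have hkj : k ≠ j := (hkl.trans hij).ne
    exact Or.inr ⟨h2.symm, triple i j k hij.ne hkl.ne' hkj.symm h1 h2.symm⟩
  by_cases hjk : j = k
  · subst hjk
    exact Or.inr ⟨h1, triple i j l hij.ne hil hkl.ne h1 (h1.trans h2)⟩
  by_cases hjl : j = l
  · subst hjl
    exact Or.inr ⟨h1.trans h2.symm, triple i j k hij.ne hik hjk h1 (h1.trans h2.symm)⟩
  left
  have := Finset.prod_dvd_prod_of_subset {i, j, k, l} Finset.univ (fun a => X - C (w a))
    (Finset.subset_univ _)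
  rw [Finset.prod_insert (by simp [hij.ne, hik, hil]), Finset.prod_insert (by simp [hjk, hjl]),
    Finset.prod_pair hkl.ne, ← h1, ← h2] at this
  convert this using 1
  ring

theorem sq_dvd_discr_of_two_pairs {π : O} (hπ : Irreducible π) {g : O[X]} (hg : g.Monic)
    {L : Type*} [Field L] (φ : O →+* L) (hφ : ∀ a, φ a = 0 → π ∣ a) {n : ℕ} (w : Fin n → L)
    (hw : g.map φ = ∏ a, (X - C (w a))) {i j k l : Fin n}
    (hij : i < j) (hkl : k < l) (hne : (i, j) ≠ (k, l)) (h1 : w i = w j) (h2 : w k = w l) :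
    π ^ 2 ∣ g.discr := by
  have h := X_sub_C_mul_dvd_derivative _ _ (double_dvd_of_two_pairs w hij hkl hne h1 h2)
  rw [← hw] at h
  refine sq_dvd_discr hπ hg φ hφ (le_of_eq ?_) h.1 h.2
  rw [(monic_X_sub_C _).natDegree_mul (monic_X_sub_C _), natDegree_X_sub_C, natDegree_X_sub_C]

end Discriminant

end TypeD

namespace TypeD

open IsLocalRing nonZeroDivisors

/-! ### Unramifiedness from simple roots, and principal maximal ideals -/

section Unramified

/-- An algebra generated, up to inverting elements, by simple roots of polynomials over the base is
formally unramified. -/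
theorem formallyUnramified_of_simple_roots {O S : Type*} [CommRing O] [CommRing S] [Algebra O S]
    (T : Set S)
    (hT : ∀ x : S, ∃ s ∈ Algebra.adjoin O T, IsUnit s ∧ x * s ∈ Algebra.adjoin O T)
    (h : ∀ t ∈ T, ∃ p : O[X], aeval t p = 0 ∧ IsUnit (aeval t (derivative p))) :
    Algebra.FormallyUnramified O S := by
  have h1 : ∀ t ∈ T, KaehlerDifferential.D O S t = 0 := by
    intro t ht
    obtain ⟨p, hp, u, hu⟩ := h t ht
    have := (KaehlerDifferential.D O S).map_aeval p t
    rw [hp, map_zero, ← hu] at this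
    have h2 := congrArg (fun z => (↑u⁻¹ : S) • z) this
    simpa [smul_smul] using h2.symm
  have h2 : ∀ x ∈ Algebra.adjoin O T, KaehlerDifferential.D O S x = 0 := by
    intro x hx
    induction hx using Algebra.adjoin_induction with
    | mem x hx => exact h1 x hx
    | algebraMap r => simp
    | add x y _ _ hx hy => rw [map_add, hx, hy, add_zero]
    | mul x y _ _ hx hy => rw [Derivation.leibniz, hx, hy]; simp
  have h3 : ∀ x, KaehlerDifferential.D O S x = 0 := by
    intro x
    obtain ⟨s, hs, ⟨u, rfl⟩, hxs⟩ := hT x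
    have h4 := h2 _ hxs
    rw [Derivation.leibniz, h2 _ hs, smul_zero, zero_add] at h4
    have h5 := congrArg (fun z => (↑u⁻¹ : S) • z) h4
    simpa [smul_smul] using h5
  rw [Algebra.formallyUnramified_iff]
  have h4 : (⊤ : Submodule S (Ω[S⁄O])) = ⊥ := by
    rw [← KaehlerDifferential.span_range_derivation, Submodule.span_eq_bot]
    rintro _ ⟨x, rfl⟩
    exact h3 x
  exact (Submodule.subsingleton_iff S).1 (subsingleton_of_bot_eq_top h4.symm)

theorem eval_derivative_prod_X_sub_C {S : Type*} [CommRing S] {n : ℕ} (w : Fin n → S) (i : Fin n) :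
    (∏ a, (X - C (w a))).eval (w i) = 0 ∧
      (∏ a, (X - C (w a))).derivative.eval (w i) = ∏ a ∈ Finset.univ.erase i, (w i - w a) := by
  rw [← Finset.mul_prod_erase Finset.univ _ (Finset.mem_univ i)]
  simp [derivative_mul, eval_prod]

theorem eval_derivative_derivative_prod_X_sub_C {S : Type*} [CommRing S] {n : ℕ} (w : Fin n → S)
    {k l : Fin n} (hkl : k ≠ l) (h : w k = w l) :
    (∏ a, (X - C (w a))).derivative.eval (w k) = 0 ∧
      (∏ a, (X - C (w a))).derivative.derivative.eval (w k) =
        2 * ∏ a ∈ (Finset.univ.erase k).erase l, (w k - w a) := by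
  have hl : l ∈ Finset.univ.erase k := by simp [hkl.symm]
  rw [← Finset.mul_prod_erase Finset.univ _ (Finset.mem_univ k),
    ← Finset.mul_prod_erase (Finset.univ.erase k) _ hl]
  simp [derivative_mul, eval_prod, h]
  ring

variable {O S : Type*} [CommRing O] [CommRing S] [Algebra O S] {n : ℕ} {g : O[X]} {α : O}
  {e : Fin n → S}

theorem IsTypeDRoots.exists_simple (h : IsTypeDRoots (algebraMap O S) g α e) (h2 : IsUnit (2 : S))
    {i : Fin n} (hi : IsUnit (e i)) (hij : ∀ j, j ≠ i → IsUnit (e i ^ 2 - e j ^ 2)) :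
    ∃ p : O[X], aeval (e i) p = 0 ∧ IsUnit (aeval (e i) (derivative p)) := by
  refine ⟨expand O 2 g, ?_, ?_⟩
  · rw [expand_aeval, ← eval_map_algebraMap, h.map_eq]
    exact (eval_derivative_prod_X_sub_C (fun a => e a ^ 2) i).1
  · rw [derivative_expand]
    simp only [map_mul, expand_aeval, map_natCast, map_pow, aeval_X]
    rw [← eval_map_algebraMap, ← derivative_map, h.map_eq]
    rw [(eval_derivative_prod_X_sub_C (fun a => e a ^ 2) i).2]
    refine IsUnit.mul ?_ (IsUnit.mul (by simpa using h2) (hi.pow _))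
    exact (Submonoid.prod_mem (IsUnit.submonoid S) fun j hj => hij j (Finset.ne_of_mem_erase hj))

/-- When exactly two squares coincide, the common value is a simple root of `g'`: the second
derivative there is twice a product of units. So `g'(X²)` replaces `g(X²)`. -/
theorem IsTypeDRoots.exists_simple_of_double (h : IsTypeDRoots (algebraMap O S) g α e)
    (h2 : IsUnit (2 : S)) {k l : Fin n} (hkl : k ≠ l) (he : e k ^ 2 = e l ^ 2) (hk : IsUnit (e k))
    (hj : ∀ j, j ≠ k → j ≠ l → IsUnit (e k ^ 2 - e j ^ 2)) :
    ∃ p : O[X], aeval (e k) p = 0 ∧ IsUnit (aeval (e k) (derivative p)) := by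
  obtain ⟨h3, h4⟩ := eval_derivative_derivative_prod_X_sub_C (fun a => e a ^ 2) hkl he
  refine ⟨expand O 2 (derivative g), ?_, ?_⟩
  · rw [expand_aeval, ← eval_map_algebraMap, ← derivative_map, h.map_eq]
    exact h3
  · rw [derivative_expand]
    simp only [map_mul, expand_aeval, map_natCast, map_pow, aeval_X]
    rw [← eval_map_algebraMap, ← derivative_map, ← derivative_map, h.map_eq, h4]
    refine IsUnit.mul (h2.mul ?_) (IsUnit.mul (by simpa using h2) (hk.pow _))
    exact (Submonoid.prod_mem (IsUnit.submonoid S) fun j hj' => hj j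
      (Finset.ne_of_mem_erase (Finset.mem_of_mem_erase hj')) (Finset.ne_of_mem_erase hj'))

/-- In an essentially finite type local algebra whose maximal ideal contains `t`, if the quotient by
`t` is unramified over the base and `t` divides the maximal ideal of the base, then `t` generates
the maximal ideal. -/
theorem maximalIdeal_eq_span_of_formallyUnramified {O R : Type*} [CommRing O] [IsLocalRing O]
    [CommRing R] [IsLocalRing R] [Algebra O R] [IsLocalHom (algebraMap O R)]
    [Algebra.EssFiniteType O R] {t : R} (ht : t ∈ maximalIdeal R)
    (hdvd : ∀ a ∈ maximalIdeal O, t ∣ algebraMap O R a)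
    (hur : Algebra.FormallyUnramified O (R ⧸ Ideal.span {t})) :
    maximalIdeal R = Ideal.span {t} := by
  have hle : Ideal.span {t} ≤ maximalIdeal R := by rwa [Ideal.span_le, Set.singleton_subset_iff]
  have hnt : Nontrivial (R ⧸ Ideal.span {t}) :=
    Ideal.Quotient.nontrivial_iff.2 (ne_top_of_le_ne_top (maximalIdeal.isMaximal R).ne_top hle)
  have hloc : IsLocalRing (R ⧸ Ideal.span {t}) := .of_surjective' _ Ideal.Quotient.mk_surjective
  have hmk : IsLocalHom (Ideal.Quotient.mk (Ideal.span {t})) :=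
    IsLocalHom.of_surjective _ Ideal.Quotient.mk_surjective
  have hOS : IsLocalHom (algebraMap O (R ⧸ Ideal.span {t})) := by
    rw [IsScalarTower.algebraMap_eq O R]
    exact RingHom.isLocalHom_comp _ _
  have h1 := Algebra.FormallyUnramified.map_maximalIdeal (R := O) (S := R ⧸ Ideal.span {t})
  have h2 : maximalIdeal (R ⧸ Ideal.span {t}) = ⊥ := by
    rw [← h1, eq_bot_iff, Ideal.map_le_iff_le_comap]
    intro a ha
    rw [Ideal.mem_comap, IsScalarTower.algebraMap_apply O R, Ideal.mem_bot,
      Ideal.Quotient.algebraMap_eq, Ideal.Quotient.eq_zero_iff_mem, Ideal.mem_span_singleton]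
    exact hdvd a ha
  refine le_antisymm (fun x hx => ?_) hle
  rw [← Ideal.Quotient.eq_zero_iff_mem, ← Ideal.mem_bot, ← h2, mem_maximalIdeal, mem_nonunits_iff]
  intro hu
  exact hx (isUnit_of_map_unit (Ideal.Quotient.mk (Ideal.span {t})) x hu)

/-- A noetherian local ring whose maximal ideal is generated by a single element, which is zero or
regular, is an integrally closed domain. -/
theorem isIntegrallyClosed_of_maximalIdeal_eq_span {R : Type*} [CommRing R] [IsLocalRing R]
    [IsNoetherianRing R] {t : R} (ht : maximalIdeal R = Ideal.span {t}) (h0 : t = 0 ∨ t ∈ R⁰) :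
    IsDomain R ∧ IsIntegrallyClosed R := by
  have hmem : ∀ (k : ℕ) (x : R), x ∈ maximalIdeal R ^ k ↔ t ^ k ∣ x := fun k x => by
    rw [ht, Ideal.span_singleton_pow, Ideal.mem_span_singleton]
  have key : ∀ a : R, a ≠ 0 → ∃ (k : ℕ) (u : Rˣ), a = t ^ k * u := by
    intro a ha
    -- Krull's intersection theorem bounds the power of `t` dividing `a`.
    have hK : a ∉ ⨅ i : ℕ, maximalIdeal R ^ i := by
      rw [Ideal.iInf_pow_eq_bot_of_isLocalRing _ (maximalIdeal.isMaximal R).ne_top]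
      exact ha
    have hex : ∃ i, a ∉ maximalIdeal R ^ i := by simpa [Submodule.mem_iInf] using hK
    obtain ⟨k, ⟨v, hv⟩, h1⟩ : ∃ k, t ^ k ∣ a ∧ ¬ t ^ (k + 1) ∣ a := by
      by_contra! hc
      obtain ⟨i, hi⟩ := hex
      refine hi ((hmem _ _).2 ?_)
      induction i with
      | zero => simp
      | succ i ih => exact hc i (ih fun h => hi (by
          rw [hmem] at h ⊢; exact hc i h))
    have hvu : IsUnit v := by
      by_contra hvu
      have hvm : v ∈ maximalIdeal R := hvu
      rw [ht, Ideal.mem_span_singleton] at hvm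
      obtain ⟨c, rfl⟩ := hvm
      exact h1 ⟨c, by rw [hv, pow_succ, mul_assoc]⟩
    exact ⟨_, hvu.unit, hv⟩
  have hdom : IsDomain R := by
    have : NoZeroDivisors R := by
      refine ⟨fun {a b} hab => ?_⟩
      by_contra! hne
      obtain ⟨k, u, rfl⟩ := key a hne.1
      obtain ⟨l, v, rfl⟩ := key b hne.2
      have h1 : t ^ (k + l) * ((u * v : Rˣ) : R) = 0 := by
        rw [← hab, Units.val_mul]; ring
      rw [Units.mul_left_eq_zero] at h1
      rcases h0 with rfl | h0
      · rcases Nat.eq_zero_or_pos k with rfl | hk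
        · rcases Nat.eq_zero_or_pos l with rfl | hl
          · simp at h1
          · exact hne.2 (by simp [hl.ne'])
        · exact hne.1 (by simp [hk.ne'])
      · have h2 := pow_mem h0 (k + l)
        rw [h1] at h2
        exact zero_notMem_nonZeroDivisors h2
    exact NoZeroDivisors.to_isDomain R
  refine ⟨hdom, ?_⟩
  have h1 := (tfae_of_isNoetherianRing_of_isLocalRing_of_isDomain R).out 4 0
  have h2 : IsPrincipalIdealRing R := h1.1 ⟨⟨t, ht⟩⟩
  infer_instance

end Unramified

end TypeD

namespace TypeD

open IsLocalRing nonZeroDivisors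

/-! ### The local theorem over a base with principal maximal ideal -/

section Local

theorem isUnit_two_map {R S : Type*} [CommRing R] [CommRing S] (h2 : IsUnit (2 : R)) (φ : R →+* S) :
    IsUnit (2 : S) := by
  rw [← map_ofNat φ 2]; exact h2.map φ

/-- The elements `eᵢ` and `eᵢ² - eⱼ²` (`i < j`). -/
def rootDegeneracy {S : Type*} [CommRing S] {n : ℕ} (e : Fin n → S) :
    Fin n ⊕ {q : Fin n × Fin n // q.1 < q.2} → S
  | Sum.inl i => e i
  | Sum.inr q => e q.1.1 ^ 2 - e q.1.2 ^ 2

theorem map_rootDegeneracy {S T : Type*} [CommRing S] [CommRing T] (φ : S →+* T) {n : ℕ}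
    (e : Fin n → S) (s : Fin n ⊕ {q : Fin n × Fin n // q.1 < q.2}) :
    φ (rootDegeneracy e s) = rootDegeneracy (fun i => φ (e i)) s := by
  cases s <;> simp [rootDegeneracy]

theorem degeneracy_eq {A : Type*} [CommRing A] (n : ℕ) (g : A[X]) (α : A)
    (s : Fin n ⊕ {q : Fin n × Fin n // q.1 < q.2}) :
    degeneracy n g α s = rootDegeneracy (etaRoot n g α) s := by
  cases s <;> rfl

theorem IsTypeDRoots.map_discr_eq_zero {O R : Type*} [CommRing O] [CommRing R] {φ : O →+* R}
    {n : ℕ} {g : O[X]} {α : O} {e : Fin n → R} (h : IsTypeDRoots φ g α e) (hg : g.Monic)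
    {k l : Fin n} (hkl : k ≠ l) (he : e k ^ 2 = e l ^ 2) : φ g.discr = 0 := by
  refine TypeD.map_discr_eq_zero φ hg (e k ^ 2) ?_
  rw [h.map_eq]
  have h1 := Finset.prod_dvd_prod_of_subset {k, l} Finset.univ
    (fun a => X - C (e a ^ 2)) (Finset.subset_univ _)
  rw [Finset.prod_pair hkl, ← he] at h1
  rwa [pow_two (X - C (e k ^ 2))]

/-- For a difference of squares `t`, two roots of `g` coincide modulo `t`, so the discriminant
vanishes in `R/(t)`. -/
theorem IsTypeDRoots.rootDegeneracy_dvd {O R : Type*} [CommRing O] [CommRing R] {φ : O →+* R}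
    {n : ℕ} {g : O[X]} {α : O} {e : Fin n → R} (h : IsTypeDRoots φ g α e) (hg : g.Monic)
    (s : Fin n ⊕ {q : Fin n × Fin n // q.1 < q.2}) :
    rootDegeneracy e s ∣ φ (α * g.discr) := by
  rw [map_mul]
  rcases s with i | ⟨⟨k, l⟩, hkl⟩
  · rw [← h.prod_eq]
    exact (Finset.dvd_prod_of_mem e (Finset.mem_univ i)).mul_right _
  · refine Dvd.dvd.mul_left ?_ _
    set t := rootDegeneracy e (Sum.inr ⟨(k, l), hkl⟩) with ht
    rw [← Ideal.mem_span_singleton, ← Ideal.Quotient.eq_zero_iff_mem]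
    refine (h.comp (Ideal.Quotient.mk (Ideal.span {t}))).map_discr_eq_zero hg hkl.ne ?_
    rw [← map_pow, ← map_pow, Ideal.Quotient.eq]
    exact Ideal.mem_span_singleton_self _

/-- A vanishing root contributes `π ∣ α`; two vanishing roots, or one with a coincidence of squares,
also give `π ∣ disc g`. Two coincidences require the Sylvester matrix argument. -/
theorem IsTypeDRoots.sq_dvd {O : Type*} [CommRing O] [IsDomain O] [IsDiscreteValuationRing O]
    {π : O} (hπ : Irreducible π) {L : Type*} [Field L] {φ : O →+* L} (hφ : ∀ a, φ a = 0 → π ∣ a)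
    {n : ℕ} {g : O[X]} {α : O} {e : Fin n → L} (h : IsTypeDRoots φ g α e) (hg : g.Monic)
    {s s' : Fin n ⊕ {q : Fin n × Fin n // q.1 < q.2}} (hss : s ≠ s')
    (hs : rootDegeneracy e s = 0) (hs' : rootDegeneracy e s' = 0) :
    π ^ 2 ∣ α * g.discr := by
  have hα : ∀ i, e i = 0 → π ∣ α := fun i hi => hφ α (by
    rw [← h.prod_eq]; exact Finset.prod_eq_zero (Finset.mem_univ i) hi)
  have hd : ∀ k l, k ≠ l → e k ^ 2 = e l ^ 2 → π ∣ g.discr := fun k l hkl he =>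
    hφ _ (h.map_discr_eq_zero hg hkl he)
  rcases s with i | ⟨⟨i, j⟩, hij⟩ <;> rcases s' with k | ⟨⟨k, l⟩, hkl⟩
  · rw [pow_two]
    refine mul_dvd_mul (hα i hs) (hd i k (by simpa using hss) ?_)
    simp only [rootDegeneracy] at hs hs'
    rw [hs, hs']
  · rw [pow_two]
    exact mul_dvd_mul (hα i hs) (hd k l hkl.ne (sub_eq_zero.1 hs'))
  · rw [pow_two]
    exact mul_dvd_mul (hα k hs') (hd i j hij.ne (sub_eq_zero.1 hs))
  · refine Dvd.dvd.mul_left ?_ _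
    exact sq_dvd_discr_of_two_pairs hπ hg φ hφ (fun a => e a ^ 2) h.map_eq hij hkl
      (by simpa using hss) (sub_eq_zero.1 hs) (sub_eq_zero.1 hs')

theorem isUnit_sq_sub_sq {S : Type*} [CommRing S] {n : ℕ} {e : Fin n → S} {i j : Fin n}
    (hij : i ≠ j)
    (h : ∀ q : {q : Fin n × Fin n // q.1 < q.2}, (q.1 = (i, j) ∨ q.1 = (j, i)) →
      IsUnit (rootDegeneracy e (Sum.inr q))) : IsUnit (e i ^ 2 - e j ^ 2) := by
  rcases lt_or_gt_of_ne hij with hlt | hlt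
  · exact h ⟨(i, j), hlt⟩ (Or.inl rfl)
  · rw [← neg_sub]
    exact (h ⟨(j, i), hlt⟩ (Or.inr rfl)).neg

/-- If at most one degeneracy occurs at a point, then, modulo the degeneracy, each root is a simple
root of a polynomial over the base. -/
theorem IsTypeDRoots.exists_simple_of_unique_degeneracy {O S : Type*} [CommRing O] [CommRing S]
    [Algebra O S] {n : ℕ} {g : O[X]} {α : O} {e : Fin n → S}
    (h : IsTypeDRoots (algebraMap O S) g α e) (h2 : IsUnit (2 : S))
    (s : Fin n ⊕ {q : Fin n × Fin n // q.1 < q.2}) (hs : rootDegeneracy e s = 0)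
    (hu : ∀ s', s' ≠ s → IsUnit (rootDegeneracy e s')) (i : Fin n) :
    ∃ p : O[X], aeval (e i) p = 0 ∧ IsUnit (aeval (e i) (derivative p)) := by
  rcases s with k | ⟨⟨k, l⟩, hkl⟩
  · by_cases hik : i = k
    · subst hik
      -- The degenerate root is zero here, hence a simple root of `X`.
      exact ⟨X, by simpa [rootDegeneracy] using hs, by simp⟩
    · exact h.exists_simple h2 (hu (Sum.inl i) (by simpa using hik)) fun j hj =>
        isUnit_sq_sub_sq hj.symm fun q _ => hu _ (by simp)
  · dsimp only at hkl
    have hkl' : e k ^ 2 = e l ^ 2 := sub_eq_zero.1 hs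
    have hi : IsUnit (e i) := hu (Sum.inl i) (by simp)
    have hunit : ∀ a b : Fin n, a ≠ b → (a, b) ≠ (k, l) → (b, a) ≠ (k, l) →
        IsUnit (e a ^ 2 - e b ^ 2) := fun a b hab h1 h2 =>
      isUnit_sq_sub_sq hab fun q hq => hu _ (by
        intro heq
        rw [Sum.inr.injEq] at heq
        subst heq
        rcases hq with hq | hq
        · exact h1 hq.symm
        · exact h2 hq.symm)
    by_cases hik : i = k
    · subst hik
      refine h.exists_simple_of_double h2 hkl.ne hkl' hi fun j hj1 hj2 => ?_
      exact hunit i j hj1.symm (by simp [hj2]) (by simp [hj1])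
    by_cases hil : i = l
    · subst hil
      refine h.exists_simple_of_double h2 hkl.ne' hkl'.symm hi fun j hj1 hj2 => ?_
      exact hunit i j hj1.symm (by simp [hik]) (by simp [hj2])
    · refine h.exists_simple h2 hi fun j hj => ?_
      exact hunit i j hj.symm (by simp [hik]) (by simp [hil])

variable {O R : Type*} [CommRing O] [IsLocalRing O] [CommRing R] [IsLocalRing R]
  [Algebra O R] [IsLocalHom (algebraMap O R)] [Algebra.EssFiniteType O R] {n : ℕ} {e : Fin n → R}

theorem maximalIdeal_eq_span_of_simple_roots
    (hgen : ∀ x : R, ∃ s ∈ Algebra.adjoin O (Set.range e), IsUnit s ∧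
      x * s ∈ Algebra.adjoin O (Set.range e))
    {π : O} (hπ : maximalIdeal O = Ideal.span {π}) {t : R} (ht : t ∈ maximalIdeal R)
    (htπ : t ∣ algebraMap O R π)
    (hs : ∀ i, ∃ p : O[X], aeval (Ideal.Quotient.mk (Ideal.span {t}) (e i)) p = 0 ∧
      IsUnit (aeval (Ideal.Quotient.mk (Ideal.span {t}) (e i)) (derivative p))) :
    maximalIdeal R = Ideal.span {t} := by
  refine maximalIdeal_eq_span_of_formallyUnramified (O := O) ht (fun a ha => ?_) ?_
  · rw [hπ, Ideal.mem_span_singleton] at ha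
    exact htπ.trans (_root_.map_dvd _ ha)
  · refine formallyUnramified_of_simple_roots
      (Set.range fun i => Ideal.Quotient.mk (Ideal.span {t}) (e i)) (fun x => ?_) ?_
    · have hmap : ∀ y ∈ Algebra.adjoin O (Set.range e), Ideal.Quotient.mk (Ideal.span {t}) y ∈
          Algebra.adjoin O (Set.range fun i => Ideal.Quotient.mk (Ideal.span {t}) (e i)) := by
        intro y hy
        have h1 : Ideal.Quotient.mkₐ O (Ideal.span {t}) y ∈ (Algebra.adjoin O (Set.range e)).map
          (Ideal.Quotient.mkₐ O (Ideal.span {t})) := ⟨y, hy, rfl⟩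
        rw [AlgHom.map_adjoin, ← Set.range_comp] at h1
        exact h1
      obtain ⟨x, rfl⟩ := Ideal.Quotient.mk_surjective x
      obtain ⟨s, hs, hsu, hxs⟩ := hgen x
      exact ⟨_, hmap s hs, hsu.map _, by rw [← map_mul]; exact hmap _ hxs⟩
    · rintro _ ⟨i, rfl⟩
      exact hs i

/-- The local form of the normality theorem. -/
theorem IsTypeDRoots.isIntegrallyClosed [IsDomain O] [IsNoetherianRing R] [Module.Flat O R]
    {g : O[X]} {α : O} (h : IsTypeDRoots (algebraMap O R) g α e) (hg : g.Monic)
    (h2 : IsUnit (2 : R))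
    (hgen : ∀ x : R, ∃ s ∈ Algebra.adjoin O (Set.range e), IsUnit s ∧
      x * s ∈ Algebra.adjoin O (Set.range e))
    {π : O} (hπ : maximalIdeal O = Ideal.span {π}) (hΔ0 : α * g.discr ≠ 0)
    (hΔ : α * g.discr ∣ π)
    (hE : ∀ s s', s ≠ s' → rootDegeneracy e s ∈ maximalIdeal R →
      rootDegeneracy e s' ∉ maximalIdeal R) :
    IsDomain R ∧ IsIntegrallyClosed R := by
  by_cases hdeg : ∃ s, rootDegeneracy e s ∈ maximalIdeal R
  · obtain ⟨s, hs⟩ := hdeg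
    set t := rootDegeneracy e s with ht
    have htΔ : t ∣ algebraMap O R (α * g.discr) := h.rootDegeneracy_dvd hg s
    have htπ : t ∣ algebraMap O R π := htΔ.trans (_root_.map_dvd _ hΔ)
    have hS := (h.comp (Ideal.Quotient.mk (Ideal.span {t})))
    have hm := maximalIdeal_eq_span_of_simple_roots hgen hπ hs htπ
      (IsTypeDRoots.exists_simple_of_unique_degeneracy (O := O) (g := g) (α := α) hS
        (isUnit_two_map h2 (Ideal.Quotient.mk (Ideal.span {t}))) s
        (by
          rw [← map_rootDegeneracy, Ideal.Quotient.eq_zero_iff_mem]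
          exact Ideal.mem_span_singleton_self _)
        (fun s' hs' => by
          rw [← map_rootDegeneracy]
          exact (of_not_not (hE s s' hs'.symm hs)).map _))
    refine isIntegrallyClosed_of_maximalIdeal_eq_span hm (Or.inr ?_)
    -- A degeneracy at this point puts the nonzero element `α · disc g` in the maximal ideal, so the
    -- base is not a field.
    have hπ0 : π ≠ 0 := by
      rintro rfl
      have h1 : α * g.discr ∈ maximalIdeal O := by
        intro hu
        exact hs (isUnit_of_dvd_unit htΔ (hu.map _))
      rw [hπ] at h1
      exact hΔ0 (by simpa using h1)
    have h3 : algebraMap O R π ∈ R⁰ :=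
      map_mem_nonZeroDivisors_of_flat (mem_nonZeroDivisors_of_ne_zero hπ0)
    obtain ⟨c, hc⟩ := htπ
    rw [hc] at h3
    exact (mul_mem_nonZeroDivisors.1 h3).1
  · push Not at hdeg
    have hu : ∀ s, IsUnit (rootDegeneracy e s) := fun s => of_not_not (hdeg s)
    have hmem : algebraMap O R π ∈ maximalIdeal R := by
      intro hu
      have h1 : π ∈ maximalIdeal O := by rw [hπ]; exact Ideal.mem_span_singleton_self _
      exact h1 (isUnit_of_map_unit _ _ hu)
    have hS := (h.comp (Ideal.Quotient.mk (Ideal.span {algebraMap O R π})))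
    have hm := maximalIdeal_eq_span_of_simple_roots hgen hπ hmem dvd_rfl fun i =>
      IsTypeDRoots.exists_simple (O := O) (g := g) (α := α) hS
        (isUnit_two_map h2 (Ideal.Quotient.mk (Ideal.span {algebraMap O R π})))
        ((hu (Sum.inl i)).map _) fun j hj => isUnit_sq_sub_sq hj.symm fun q _ => by
          rw [← map_rootDegeneracy (Ideal.Quotient.mk (Ideal.span {algebraMap O R π})) e]
          exact (hu _).map _
    refine isIntegrallyClosed_of_maximalIdeal_eq_span hm ?_
    by_cases hπ0 : π = 0
    · left; rw [hπ0, map_zero]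
    · right
      exact map_mem_nonZeroDivisors_of_flat (mem_nonZeroDivisors_of_ne_zero hπ0)

end Local

end TypeD

namespace TypeD

open IsLocalRing nonZeroDivisors

universe u

/-! ### Globalization and the two statements -/

section Main

variable {A : Type u} [CommRing A]

theorem exists_maximalIdeal_eq_span [IsNoetherianRing A] [IsNormalRing A] {a : A}
    (hsq : IsSquarefreeElt a) (x : PrimeSpectrum A) (hx : x.asIdeal.height ≤ 1) :
    ∃ π, maximalIdeal (Localization.AtPrime x.asIdeal) = Ideal.span {π} ∧
      algebraMap A (Localization.AtPrime x.asIdeal) a ∣ π := by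
  rcases hx.lt_or_eq with hx | hx
  -- At height zero the local ring is a field, and `π = 0` lets it share the local theorem with the
  -- discrete valuation case.
  · refine ⟨0, ?_, dvd_zero _⟩
    rw [Order.lt_one_iff] at hx
    have h1 := IsLocalization.AtPrime.ringKrullDim_eq_height x.asIdeal
      (Localization.AtPrime x.asIdeal)
    rw [hx] at h1
    have : Ring.KrullDimLE 0 (Localization.AtPrime x.asIdeal) := (Ring.krullDimLE_iff).2 h1.le
    have h2 : IsField (Localization.AtPrime x.asIdeal) := Ring.KrullDimLE.isField_of_isDomain
    rw [isField_iff_maximalIdeal_eq.1 h2]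
    simp
  · let := isDiscreteValuationRing_localization A x hx
    obtain ⟨π, hπ⟩ := IsDiscreteValuationRing.exists_irreducible (Localization.AtPrime x.asIdeal)
    refine ⟨π, hπ.maximalIdeal_eq, ?_⟩
    rw [← IsDiscreteValuationRing.addVal_le_iff_dvd, IsDiscreteValuationRing.addVal_uniformizer hπ]
    rcases hsq x hx with h | h
    · exact (le_of_eq h).trans zero_le_one
    · exact le_of_eq h

variable (n : ℕ) (g : A[X]) (α : A)

theorem algebraMap_mem_adjoin_etaRoot {O R : Type*} [CommRing O] [CommRing R] [Algebra A O]
    [Algebra O R] [Algebra A R] [IsScalarTower A O R] [Algebra (DSplit n g α) R]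
    [IsScalarTower A (DSplit n g α) R] (b : DSplit n g α) :
    algebraMap (DSplit n g α) R b ∈
      Algebra.adjoin O (Set.range fun i => algebraMap (DSplit n g α) R (etaRoot n g α i)) := by
  obtain ⟨p, rfl⟩ := Ideal.Quotient.mk_surjective b
  induction p using MvPolynomial.induction_on with
  | C a =>
    have h1 : Ideal.Quotient.mk (splitIdeal n g α) (MvPolynomial.C a) =
      algebraMap A (DSplit n g α) a := rfl
    rw [h1, ← IsScalarTower.algebraMap_apply, IsScalarTower.algebraMap_apply A O R]
    exact Subalgebra.algebraMap_mem _ _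
  | add p q hp hq => rw [map_add, map_add]; exact add_mem hp hq
  | mul_X p i hp =>
    rw [map_mul, map_mul]
    exact mul_mem hp (Algebra.subset_adjoin ⟨i, rfl⟩)

variable {n g α}

section Setup

variable (q : Ideal (DSplit n g α)) [q.IsPrime]
  [Algebra (Localization.AtPrime (q.under A)) (Localization.AtPrime q)]
  [Localization.AtPrime.IsLiesOverAlgebra (q.under A) q]

theorem isTypeDRoots_localization :
    IsTypeDRoots (algebraMap (Localization.AtPrime (q.under A)) (Localization.AtPrime q))
      (g.map (algebraMap A (Localization.AtPrime (q.under A))))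
      (algebraMap A (Localization.AtPrime (q.under A)) α)
      (fun i => algebraMap (DSplit n g α) (Localization.AtPrime q) (etaRoot n g α i)) := by
  have h := IsTypeDRoots.comp (T := Localization.AtPrime q) (isTypeDRoots_etaRoot n g α)
    (algebraMap (DSplit n g α) (Localization.AtPrime q))
  have h1 : (algebraMap (DSplit n g α) (Localization.AtPrime q)).comp
      (algebraMap A (DSplit n g α)) =
      (algebraMap (Localization.AtPrime (q.under A)) (Localization.AtPrime q)).comp
        (algebraMap A (Localization.AtPrime (q.under A))) := by
    rw [← IsScalarTower.algebraMap_eq, ← IsScalarTower.algebraMap_eq]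
  rw [h1] at h
  exact ⟨by rw [Polynomial.map_map, h.map_eq], h.prod_eq⟩

theorem isLocalHom_of_isLiesOverAlgebra :
    IsLocalHom (algebraMap (Localization.AtPrime (q.under A)) (Localization.AtPrime q)) := by
  rw [Localization.AtPrime.IsLiesOverAlgebra.algebraMap_eq (p := q.under A) (P := q)]
  exact Localization.isLocalHom_localRingHom _ _ _ _

end Setup

theorem map_reducedDiscr {R : Type*} [CommRing R] (φ : A →+* R) (hg : g.Monic) :
    φ (reducedDiscr g α) = φ α * (g.map φ).discr := by
  rw [reducedDiscr, map_mul, map_discr_of_monic φ hg]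

theorem isNormalRing_dSplit [IsNoetherianRing A] [IsNormalRing A] (h2 : IsUnit (2 : A))
    (hg : g.Monic) (hgn : g.natDegree = n) (hα : α ^ 2 = (-1) ^ n * g.coeff 0)
    (hΔ : reducedDiscr g α ∈ A⁰) (hsq : IsSquarefreeElt (reducedDiscr g α))
    (hE : CodimGE 2 (badLocus n g α)) : IsNormalRing (DSplit n g α) := by
  have hflat := flat_dSplit n h2 g hg hgn α hα
  refine isNormalRing_of_flat (A := A) fun q _ hq => ?_
  let := Localization.AtPrime.algebraOfLiesOver (q.under A) q
  have hloc := isLocalHom_of_isLiesOverAlgebra q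
  let x : PrimeSpectrum A := ⟨q.under A, inferInstance⟩
  have hdom : IsDomain (Localization.AtPrime (q.under A)) := IsNormalRing.isDomain_localization x
  obtain ⟨π, hπ, hdvd⟩ := exists_maximalIdeal_eq_span hsq x hq
  have hess : Algebra.EssFiniteType (Localization.AtPrime (q.under A)) (Localization.AtPrime q) :=
    Algebra.EssFiniteType.of_comp A _ _
  have hnoeth : IsNoetherianRing (Localization.AtPrime q) :=
    IsLocalization.isNoetherianRing q.primeCompl _ inferInstance
  have h0 : algebraMap A (Localization.AtPrime (q.under A)) (reducedDiscr g α) ≠ 0 :=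
    nonZeroDivisors.ne_zero (IsLocalization.map_nonZeroDivisors_le (q.under A).primeCompl _
      ⟨_, hΔ, rfl⟩)
  have hdvd' : algebraMap A (Localization.AtPrime (q.under A)) (reducedDiscr g α) ∣ π := hdvd
  rw [map_reducedDiscr _ hg] at h0 hdvd'
  refine (isTypeDRoots_localization q).isIntegrallyClosed (hg.map _)
    (isUnit_two_map h2 (algebraMap A (Localization.AtPrime q))) (fun y => ?_) hπ h0 hdvd' ?_
  · obtain ⟨b, s, rfl⟩ := IsLocalization.exists_mk'_eq q.primeCompl y
    refine ⟨algebraMap _ _ (s : DSplit n g α), algebraMap_mem_adjoin_etaRoot n g α _,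
      IsLocalization.map_units _ s, ?_⟩
    rw [IsLocalization.mk'_spec]
    exact algebraMap_mem_adjoin_etaRoot n g α _
  · intro s s' hss hs hs'
    rw [← map_rootDegeneracy, ← degeneracy_eq, IsLocalization.AtPrime.to_map_mem_maximal_iff _ q]
      at hs hs'
    have h1 := hE x ⟨⟨q, inferInstance⟩, ⟨s, s', hss, hs, hs'⟩, rfl⟩
    exact absurd (h1.trans hq) (by norm_num)

theorem isSquarefreeElt_of_codimGE [IsNoetherianRing A] [IsNormalRing A] {a : A}
    (h : CodimGE 2 (doubleVanishing a)) : IsSquarefreeElt a := by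
  intro x hx
  by_contra! hne
  let := isDiscreteValuationRing_localization A x hx
  obtain ⟨π, hπ⟩ := IsDiscreteValuationRing.exists_irreducible (Localization.AtPrime x.asIdeal)
  have h1 : (2 : ℕ∞) ≤ primeVal x hx a := by
    have h2 : (1 : ℕ∞) < primeVal x hx a :=
      lt_of_le_of_ne (Order.one_le_iff_ne_zero.2 hne.1) hne.2.symm
    simpa [one_add_one_eq_two] using Order.add_one_le_of_lt h2
  have h2 : π ^ 2 ∣ algebraMap A (Localization.AtPrime x.asIdeal) a := by
    rw [← IsDiscreteValuationRing.addVal_le_iff_dvd, IsDiscreteValuationRing.addVal_pow,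
      IsDiscreteValuationRing.addVal_uniformizer hπ, two_nsmul,
      one_add_one_eq_two]
    exact h1
  have h3 := h x (by
    rw [doubleVanishing, Set.mem_ofPred_eq, hπ.maximalIdeal_eq, Ideal.span_singleton_pow,
      Ideal.mem_span_singleton]
    exact h2)
  rw [hx] at h3
  exact absurd h3 (by norm_num)

theorem codimGE_badLocus [IsNoetherianRing A] [IsNormalRing A] (hg : g.Monic)
    (hΔ : reducedDiscr g α ∈ A⁰) (h : CodimGE 2 (doubleVanishing (reducedDiscr g α))) :
    CodimGE 2 (badLocus n g α) := by
  rintro _ ⟨⟨q, hq⟩, ⟨s, s', hss, hs, hs'⟩, rfl⟩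
  let x : PrimeSpectrum A := ⟨q.under A, inferInstance⟩
  change 2 ≤ x.asIdeal.height
  by_contra! hlt
  have hle : x.asIdeal.height ≤ 1 :=
    Order.le_of_lt_add_one (by simpa [one_add_one_eq_two] using hlt)
  have hdvd := (isTypeDRoots_etaRoot n g α).rootDegeneracy_dvd hg s
  have hmem : reducedDiscr g α ∈ x.asIdeal := by
    change algebraMap A (DSplit n g α) (α * g.discr) ∈ q
    simp only [degeneracy_eq] at hs
    exact q.mem_of_dvd hdvd hs
  rcases hle.lt_or_eq with hx | hx
  · rw [Order.lt_one_iff, Ideal.height_eq_zero_iff] at hx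
    -- Height zero is impossible: `Δ` lies in the prime, whereas a minimal prime contains no regular
    -- element.
    exact Set.disjoint_left.1 (Ideal.disjoint_nonZeroDivisors_of_mem_minimalPrimes hx) hmem hΔ
  · have hdom : IsDomain (Localization.AtPrime (q.under A)) :=
      IsNormalRing.isDomain_localization x
    have hdvr : IsDiscreteValuationRing (Localization.AtPrime (q.under A)) :=
      isDiscreteValuationRing_localization A x hx
    obtain ⟨π, hπ⟩ := IsDiscreteValuationRing.exists_irreducible (Localization.AtPrime (q.under A))
    have hgoal : π ^ 2 ∣ algebraMap A (Localization.AtPrime (q.under A)) (reducedDiscr g α) := by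
      let := Localization.AtPrime.algebraOfLiesOver (q.under A) q
      have hloc := isLocalHom_of_isLiesOverAlgebra q
      rw [map_reducedDiscr _ hg]
      -- The degeneracies vanish in the residue field of `B` at `q`, an extension of that of `A_p`;
      -- the kernel of the map from `A_p` lies in `(π)`.
      refine ((isTypeDRoots_localization q).comp (residue (Localization.AtPrime q))).sq_dvd hπ
        (fun a ha => ?_) (hg.map _) hss ?_ ?_
      · rw [← Ideal.mem_span_singleton, ← hπ.maximalIdeal_eq]
        intro hu
        rw [RingHom.comp_apply, residue_eq_zero_iff] at ha
        exact ha (hu.map _)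
      all_goals
        rw [← map_rootDegeneracy (residue (Localization.AtPrime q)), residue_eq_zero_iff,
          ← map_rootDegeneracy, ← degeneracy_eq,
          IsLocalization.AtPrime.to_map_mem_maximal_iff _ q]
        assumption
    have h3 := h x (by
      rw [doubleVanishing, Set.mem_ofPred_eq]
      change _ ∈ maximalIdeal (Localization.AtPrime (q.under A)) ^ 2
      rw [hπ.maximalIdeal_eq, Ideal.span_singleton_pow, Ideal.mem_span_singleton]
      exact hgoal)
    exact absurd (h3.trans hle) (by norm_num)

end Main

end TypeD

theorem mainTheorem7 {A : Type*} [CommRing A] [IsNoetherianRing A] [TypeD.IsNormalRing A]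
    (h2 : IsUnit (2 : A)) (n : ℕ) (g : Polynomial A) (hg : g.Monic) (hgn : g.natDegree = n)
    (α : A) (hα : α ^ 2 = (-1) ^ n * g.coeff 0)
    (hΔ : TypeD.reducedDiscr g α ∈ nonZeroDivisors A) :
    (TypeD.IsSquarefreeElt (TypeD.reducedDiscr g α) →
        TypeD.CodimGE 2 (TypeD.badLocus n g α) →
        TypeD.IsNormalRing (TypeD.DSplit n g α)) ∧
      (TypeD.CodimGE 2 (TypeD.doubleVanishing (TypeD.reducedDiscr g α)) →
        TypeD.IsSquarefreeElt (TypeD.reducedDiscr g α) ∧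
          TypeD.IsNormalRing (TypeD.DSplit n g α)) := by
  exact ⟨fun hsq hE => TypeD.isNormalRing_dSplit h2 hg hgn hα hΔ hsq hE, fun hV =>
    ⟨TypeD.isSquarefreeElt_of_codimGE hV, TypeD.isNormalRing_dSplit h2 hg hgn hα hΔ
      (TypeD.isSquarefreeElt_of_codimGE hV) (TypeD.codimGE_badLocus hg hΔ hV)⟩⟩
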